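/- Let $R$ be a commutative ring. For a polynomial $R$-algebra $A$ put $B := A\otimes_R R/2$, let $B^{(1)} := R/2\otimes_{\varphi,R/2}B$ be its Frobenius twist ($\varphi(x)=x^2$ on $R/2$), regard $B$ as a $B^{(1)}$-algebra through the relative Frobenius $r\otimes b\mapsto r\,b^2$, put $C:=B\otimes_{B^{(1)}}B$, and let $J$ be the kernel of the multiplication map $C\to B$. For $n\ge 0$ let $J^n$ be the $n$-th power of this ideal of $C$, so that $J^0=C$. Extend the functors $A\mapsto J^n$ and the inclusions $J^{n+1}\to J^n$ from finitely generated polynomial $R$-algebras to simplicial commutative $R$-algebras $A$ by left Kan extension, with values in the derived category of abelian groups; concretely, if $P_\bullet\to A$ is a weak equivalence of simplicial commutative $R$-algebras with each $P_m$ a polynomial $R$-algebra (possibly on infinitely many variables), then $J^n$ of $A$ is represented by the chain complex of the simplicial abelian group $m\mapsto J(P_m)^n$. An object is called $k$-connected if its homology vanishes in all degrees $\le k$. Let $A$ be a simplicial commutative $R$-algebra. If $J$ (evaluated at $A$) is $0$-connected, then $J^n$ is $(n-1)$-connected for every integer $n\ge 1$. In particular, the filtration $\cdots\to J^2\to J\to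 C$ on $C=B\otimes_{B^{(1)}}B$ is complete, i.e. its limit $\lim_n J^n$ in the derived category is zero. -/

import Mathlib

open CategoryTheory CategoryTheory.Limits
open scoped TensorProduct

universe u

noncomputable section

namespace RealHochschild

/-! ### The relative Frobenius in characteristic two -/

/-- The Frobenius `x ↦ x ^ 2` of a commutative ring in which `2 = 0`. -/
def frob (k : Type u) [CommRing k] [h : Fact ((2 : k) = 0)] : k →+* k where
  toFun x := x ^ 2
  map_one' := one_pow 2
  map_mul' x y := mul_pow x y 2
  map_zero' := zero_pow two_ne_zero
  map_add' x y := by rw [add_sq, h.out, zero_mul, zero_mul, add_zero]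

@[simp]
theorem frob_apply (k : Type u) [CommRing k] [Fact ((2 : k) = 0)] (x : k) :
    frob k x = x ^ 2 := rfl

/-- The ring `k`, regarded as a `k`-algebra through the Frobenius `φ : k → k`. -/
def FrobBase (k : Type u) : Type u := k

instance (k : Type u) [CommRing k] : CommRing (FrobBase k) := inferInstanceAs (CommRing k)

instance (k : Type u) [CommRing k] [Fact ((2 : k) = 0)] : Algebra k (FrobBase k) :=
  RingHom.toAlgebra (frob k : k →+* k)

/-- The Frobenius twist `B⁽¹⁾ = k ⊗_{φ, k} B` of a `k`-algebra `B`. -/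
def FrobTwist (k : Type u) [CommRing k] [Fact ((2 : k) = 0)]
    (B : Type u) [CommRing B] [Algebra k B] : Type u := FrobBase k ⊗[k] B

instance (k : Type u) [CommRing k] [Fact ((2 : k) = 0)]
    (B : Type u) [CommRing B] [Algebra k B] : CommRing (FrobTwist k B) :=
  inferInstanceAs (CommRing (FrobBase k ⊗[k] B))

/-- The pure tensor `r ⊗ b` of `B⁽¹⁾ = k ⊗_{φ, k} B`. -/
def FrobTwist.tmul (k : Type u) [CommRing k] [Fact ((2 : k) = 0)]
    {B : Type u} [CommRing B] [Algebra k B] (r : k) (b : B) : FrobTwist k B :=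
  TensorProduct.tmul k (M := FrobBase k) r b

theorem two_eq_zero (k : Type u) [CommRing k] [h : Fact ((2 : k) = 0)]
    (B : Type u) [CommRing B] [Algebra k B] : (2 : B) = 0 := by
  rw [← map_ofNat (algebraMap k B) 2, h.out, map_zero]

/-- The relative Frobenius `B⁽¹⁾ → B`, `r ⊗ b ↦ r • b ^ 2`, of `k → B`. -/
def relFrob (k : Type u) [CommRing k] [Fact ((2 : k) = 0)]
    (B : Type u) [CommRing B] [Algebra k B] : FrobTwist k B →+* B :=
  haveI : Fact ((2 : B) = 0) := ⟨two_eq_zero k B⟩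
  (Algebra.TensorProduct.lmul' (S := B) k : B ⊗[k] B →ₐ[k] B).toRingHom.comp
    (Algebra.TensorProduct.mapRingHom (S := FrobBase k) (T := B) (S' := B) (T' := B)
      (frob k) (algebraMap k B : k →+* B) (frob B) rfl
      (by ext x; simp))

theorem relFrob_tmul (k : Type u) [CommRing k] [Fact ((2 : k) = 0)]
    (B : Type u) [CommRing B] [Algebra k B] (r : k) (b : B) :
    relFrob k B (FrobTwist.tmul k r b) = r • b ^ 2 := by
  have : Fact ((2 : B) = 0) := ⟨two_eq_zero k B⟩
  rw [Algebra.smul_def]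
  exact (congrArg (Algebra.TensorProduct.lmul' (S := B) k)
    (Algebra.TensorProduct.mapRingHom_tmul (S := FrobBase k) (T := B) (S' := B) (T' := B)
      (frob k) (algebraMap k B : k →+* B) (frob B) rfl (by ext x; simp) r b)).trans
    (Algebra.TensorProduct.lmul'_apply_tmul (R := k) _ _)

theorem FrobTwist.induction_on (k : Type u) [CommRing k] [Fact ((2 : k) = 0)]
    {B : Type u} [CommRing B] [Algebra k B] {p : FrobTwist k B → Prop} (x : FrobTwist k B)
    (zero : p 0) (tmul : ∀ (r : k) (b : B), p (FrobTwist.tmul k r b))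
    (add : ∀ x y, p x → p y → p (x + y)) : p x :=
  TensorProduct.induction_on (R := k) (M := FrobBase k) (N := B) (motive := p) x zero tmul add

/-- `B` is a `B⁽¹⁾`-algebra through the relative Frobenius. -/
instance (k : Type u) [CommRing k] [Fact ((2 : k) = 0)]
    (B : Type u) [CommRing B] [Algebra k B] : Algebra (FrobTwist k B) B :=
  (relFrob k B).toAlgebra

/-- Functoriality of the Frobenius twist: `r ⊗ b ↦ r ⊗ f b`. -/
def FrobTwist.map (k : Type u) [CommRing k] [Fact ((2 : k) = 0)]
    {B B' : Type u} [CommRing B] [Algebra k B] [CommRing B'] [Algebra k B'] (f : B →ₐ[k] B') :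
    FrobTwist k B →+* FrobTwist k B' :=
  (Algebra.TensorProduct.map (AlgHom.id k (FrobBase k)) f).toRingHom

theorem FrobTwist.map_tmul (k : Type u) [CommRing k] [Fact ((2 : k) = 0)]
    {B B' : Type u} [CommRing B] [Algebra k B] [CommRing B'] [Algebra k B'] (f : B →ₐ[k] B')
    (r : k) (b : B) : FrobTwist.map k f (FrobTwist.tmul k r b) = FrobTwist.tmul k r (f b) := rfl

/-- The relative Frobenius is natural. -/
theorem relFrob_naturality (k : Type u) [CommRing k] [Fact ((2 : k) = 0)]
    {B B' : Type u} [CommRing B] [Algebra k B] [CommRing B'] [Algebra k B'] (f : B →ₐ[k] B') :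
    (f : B →+* B').comp (algebraMap (FrobTwist k B) B) =
      (algebraMap (FrobTwist k B') B').comp (FrobTwist.map k f) := by
  refine RingHom.ext fun x => ?_
  change f (relFrob k B x) = relFrob k B' (FrobTwist.map k f x)
  induction x using FrobTwist.induction_on with
  | zero => simp
  | tmul r b => rw [FrobTwist.map_tmul, relFrob_tmul, relFrob_tmul, map_smul, map_pow]
  | add y z hy hz => rw [map_add, map_add, map_add, map_add, hy, hz]

/-- The ring `C = B ⊗_{B⁽¹⁾} B`. -/
abbrev FrobTensor (k : Type u) [CommRing k] [Fact ((2 : k) = 0)]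
    (B : Type u) [CommRing B] [Algebra k B] : Type u := B ⊗[FrobTwist k B] B

/-- The ideal `J` of `C = B ⊗_{B⁽¹⁾} B`: the kernel of the multiplication map `C → B`. -/
def mulKer (k : Type u) [CommRing k] [Fact ((2 : k) = 0)]
    (B : Type u) [CommRing B] [Algebra k B] : Ideal (FrobTensor k B) :=
  RingHom.ker (Algebra.TensorProduct.lmul' (S := B) (FrobTwist k B))

/-- Functoriality of `C`: `b ⊗ b' ↦ f b ⊗ f b'`. -/
def FrobTensor.map (k : Type u) [CommRing k] [Fact ((2 : k) = 0)]
    {B B' : Type u} [CommRing B] [Algebra k B] [CommRing B'] [Algebra k B'] (f : B →ₐ[k] B') :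
    FrobTensor k B →+* FrobTensor k B' :=
  Algebra.TensorProduct.mapRingHom (FrobTwist.map k f) (f : B →+* B') (f : B →+* B')
    (relFrob_naturality k f) (relFrob_naturality k f)

theorem FrobTensor.map_tmul (k : Type u) [CommRing k] [Fact ((2 : k) = 0)]
    {B B' : Type u} [CommRing B] [Algebra k B] [CommRing B'] [Algebra k B'] (f : B →ₐ[k] B')
    (x y : B) : FrobTensor.map k f (x ⊗ₜ y) = f x ⊗ₜ f y :=
  Algebra.TensorProduct.mapRingHom_tmul ..

theorem FrobTensor.map_id (k : Type u) [CommRing k] [Fact ((2 : k) = 0)]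
    {B : Type u} [CommRing B] [Algebra k B] (x : FrobTensor k B) :
    FrobTensor.map k (AlgHom.id k B) x = x := by
  induction x using TensorProduct.induction_on with
  | zero => simp
  | tmul x y => rw [FrobTensor.map_tmul]; rfl
  | add x y hx hy => rw [map_add, hx, hy]

theorem FrobTensor.map_comp (k : Type u) [CommRing k] [Fact ((2 : k) = 0)]
    {B B' B'' : Type u} [CommRing B] [Algebra k B] [CommRing B'] [Algebra k B']
    [CommRing B''] [Algebra k B''] (f : B →ₐ[k] B') (g : B' →ₐ[k] B'') (x : FrobTensor k B) :
    FrobTensor.map k (g.comp f) x = FrobTensor.map k g (FrobTensor.map k f x) := by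
  induction x using TensorProduct.induction_on with
  | zero => simp
  | tmul x y => simp only [FrobTensor.map_tmul]; rfl
  | add x y hx hy => rw [map_add, hx, hy, map_add, map_add]

theorem mulKer_le_comap (k : Type u) [CommRing k] [Fact ((2 : k) = 0)]
    {B B' : Type u} [CommRing B] [Algebra k B] [CommRing B'] [Algebra k B'] (f : B →ₐ[k] B') :
    mulKer k B ≤ (mulKer k B').comap (FrobTensor.map k f) := by
  intro x hx
  have key : ∀ y : FrobTensor k B,
      Algebra.TensorProduct.lmul' (S := B') (FrobTwist k B') (FrobTensor.map k f y) =
        f (Algebra.TensorProduct.lmul' (S := B) (FrobTwist k B) y) := by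
    intro y
    induction y using TensorProduct.induction_on with
    | zero => simp
    | tmul y z =>
      rw [FrobTensor.map_tmul, Algebra.TensorProduct.lmul'_apply_tmul,
        Algebra.TensorProduct.lmul'_apply_tmul, map_mul]
    | add y z hy hz => rw [map_add, map_add, hy, hz, map_add, map_add]
  have hx' : Algebra.TensorProduct.lmul' (S := B) (FrobTwist k B) x = 0 := hx
  change Algebra.TensorProduct.lmul' (S := B') (FrobTwist k B') (FrobTensor.map k f x) = 0
  rw [key, hx', map_zero]

theorem mulKer_pow_le_comap (k : Type u) [CommRing k] [Fact ((2 : k) = 0)]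
    {B B' : Type u} [CommRing B] [Algebra k B] [CommRing B'] [Algebra k B'] (f : B →ₐ[k] B')
    (n : ℕ) : mulKer k B ^ n ≤ (mulKer k B' ^ n).comap (FrobTensor.map k f) :=
  (Ideal.pow_right_mono (mulKer_le_comap k f) n).trans (Ideal.le_comap_pow _ n)

/-- The additive map `J ^ n → J' ^ n` induced by a map of `k`-algebras `f : B → B'`. -/
def mulKerPowMap (k : Type u) [CommRing k] [Fact ((2 : k) = 0)]
    {B B' : Type u} [CommRing B] [Algebra k B] [CommRing B'] [Algebra k B'] (n : ℕ)
    (f : B →ₐ[k] B') : ↥(mulKer k B ^ n) →+ ↥(mulKer k B' ^ n) where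
  toFun x := ⟨FrobTensor.map k f x, mulKer_pow_le_comap k f n x.2⟩
  map_zero' := Subtype.ext (map_zero _)
  map_add' _ _ := Subtype.ext (map_add _ _ _)

/-! ### The functors `A ↦ B`, `A ↦ J ^ n` on commutative `R`-algebras -/

/-- The ring `R/2`. -/
abbrev ModTwo (R : Type u) [CommRing R] : Type u := R ⧸ Ideal.span {(2 : R)}

instance (R : Type u) [CommRing R] : Fact ((2 : ModTwo R) = 0) :=
  ⟨Ideal.Quotient.eq_zero_iff_mem.2 (Ideal.mem_span_singleton_self 2)⟩

/-- The `R/2`-algebra `B = R/2 ⊗_R A`. -/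
abbrev BaseModTwo (R : Type u) [CommRing R] (A : Type u) [CommRing A] [Algebra R A] : Type u :=
  ModTwo R ⊗[R] A

/-- Functoriality of `A ↦ B = R/2 ⊗_R A`. -/
def BaseModTwo.map (R : Type u) [CommRing R] {A A' : Type u} [CommRing A] [Algebra R A]
    [CommRing A'] [Algebra R A'] (f : A →ₐ[R] A') :
    BaseModTwo R A →ₐ[ModTwo R] BaseModTwo R A' :=
  Algebra.TensorProduct.map (AlgHom.id (ModTwo R) (ModTwo R)) f

theorem BaseModTwo.map_id (R : Type u) [CommRing R] (A : Type u) [CommRing A] [Algebra R A] :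
    BaseModTwo.map R (AlgHom.id R A) = AlgHom.id (ModTwo R) (BaseModTwo R A) :=
  Algebra.TensorProduct.map_id

theorem BaseModTwo.map_comp (R : Type u) [CommRing R] {A A' A'' : Type u} [CommRing A]
    [Algebra R A] [CommRing A'] [Algebra R A'] [CommRing A''] [Algebra R A'']
    (f : A →ₐ[R] A') (g : A' →ₐ[R] A'') :
    BaseModTwo.map R (g.comp f) = (BaseModTwo.map R g).comp (BaseModTwo.map R f) := by
  refine Algebra.TensorProduct.ext (by ext) (by ext; rfl)

/-- The functor `A ↦ J ^ n`, where `B = R/2 ⊗_R A` and `J` is the kernel of the multiplication map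
`B ⊗_{B⁽¹⁾} B → B`. In particular `n = 0` gives `A ↦ B ⊗_{B⁽¹⁾} B`. -/
def powJ (R : Type u) [CommRing R] (n : ℕ) : CommAlgCat.{u} R ⥤ AddCommGrpCat.{u} where
  obj A := AddCommGrpCat.of ↥(mulKer (ModTwo R) (BaseModTwo R A) ^ n)
  map f := AddCommGrpCat.ofHom (mulKerPowMap (ModTwo R) n (BaseModTwo.map R f.hom))
  map_id A := by
    ext x
    change FrobTensor.map (ModTwo R) (BaseModTwo.map R (AlgHom.id R A)) x.1 = x.1
    rw [BaseModTwo.map_id, FrobTensor.map_id]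
  map_comp f g := by
    ext x
    change FrobTensor.map (ModTwo R) (BaseModTwo.map R (g.hom.comp f.hom)) x.1 =
      FrobTensor.map (ModTwo R) (BaseModTwo.map R g.hom)
        (FrobTensor.map (ModTwo R) (BaseModTwo.map R f.hom) x.1)
    rw [BaseModTwo.map_comp, FrobTensor.map_comp]

/-- The inclusion `J ^ (n + 1) → J ^ n`. -/
def powJIncl (R : Type u) [CommRing R] (n : ℕ) : powJ R (n + 1) ⟶ powJ R n where
  app A := AddCommGrpCat.ofHom
    (AddSubgroup.inclusion (H := (mulKer (ModTwo R) (BaseModTwo R A) ^ (n + 1)).toAddSubgroup)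
      (K := (mulKer (ModTwo R) (BaseModTwo R A) ^ n).toAddSubgroup)
      (Ideal.pow_le_pow_right n.le_succ))
  naturality _ _ _ := rfl

/-! ### Left Kan extension to simplicial commutative algebras -/

/-- The chain complex `⋯ → X₂ → X₁ → X₀` (alternating sums of faces) of a simplicial abelian group.
Its homology groups are the homotopy groups of `X`. -/
abbrev chains : SimplicialObject AddCommGrpCat.{u} ⥤ ChainComplex AddCommGrpCat.{u} ℕ :=
  AlgebraicTopology.alternatingFaceMapComplex AddCommGrpCat.{u}

/-- The underlying additive group of a commutative `R`-algebra. -/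
def underlyingAb (R : Type u) [CommRing R] : CommAlgCat.{u} R ⥤ AddCommGrpCat.{u} where
  obj A := AddCommGrpCat.of A
  map f := AddCommGrpCat.ofHom (f.hom : _ →+ _)

/-- A resolution `P → A` of a simplicial commutative `R`-algebra by polynomial algebras:
a weak equivalence of simplicial commutative `R`-algebras (an isomorphism on homotopy groups) from
a simplicial `R`-algebra each of whose terms is a polynomial algebra on some set of variables. -/
structure PolynomialResolution (R : Type u) [CommRing R]
    (A : SimplicialObject (CommAlgCat.{u} R)) where
  /-- the resolving simplicial algebra -/
  alg : SimplicialObject (CommAlgCat.{u} R)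
  /-- the augmentation -/
  aug : alg ⟶ A
  polynomial : ∀ m : SimplexCategoryᵒᵖ,
    ∃ σ : Type u, Nonempty (MvPolynomial σ R ≃ₐ[R] alg.obj m)
  quasiIso_aug : QuasiIso
    (chains.map (((SimplicialObject.whiskering _ _).obj (underlyingAb R)).map aug))

/-- The left Kan extension (nonabelian left derived functor) to simplicial commutative `R`-algebras
of the restriction of `F` to polynomial algebras, evaluated at `A`. The extension preserves sifted
colimits, and `A` is the geometric realization of the simplicial diagram `m ↦ P_m` for every
polynomial resolution `P → A`; so its value at `A` is the realization of `m ↦ F(P_m)`, an object of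
the derived category of abelian groups represented by the complex of this simplicial abelian
group. The functor `F` is required to commute with filtered colimits, so that it is determined on
all polynomial algebras by the finitely generated ones, as is the case for `A ↦ J ^ n`. -/
def leftKan {R : Type u} [CommRing R] (F : CommAlgCat.{u} R ⥤ AddCommGrpCat.{u})
    {A : SimplicialObject (CommAlgCat.{u} R)} (P : PolynomialResolution R A) :
    ChainComplex AddCommGrpCat.{u} ℕ :=
  chains.obj (((SimplicialObject.whiskering _ _).obj F).obj P.alg)

/-- Functoriality of `leftKan` in the functor. -/
def leftKanMap {R : Type u} [CommRing R] {F G : CommAlgCat.{u} R ⥤ AddCommGrpCat.{u}} (τ : F ⟶ G)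
    {A : SimplicialObject (CommAlgCat.{u} R)} (P : PolynomialResolution R A) :
    leftKan F P ⟶ leftKan G P :=
  chains.map (((SimplicialObject.whiskering _ _).map τ).app P.alg)

/-- A connective complex is `n`-connected if its homology vanishes in all degrees `≤ n`. -/
def IsConnectedUpTo (X : ChainComplex AddCommGrpCat.{u} ℕ) (n : ℤ) : Prop :=
  ∀ i : ℕ, (i : ℤ) ≤ n → IsZero (X.homology i)

/-- The map `1 - shift : ∏ₙ Xₙ ⟶ ∏ₙ Xₙ`, `(xₙ)ₙ ↦ (xₙ - fₙ(xₙ₊₁))ₙ`, of a tower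
`⋯ → X₂ → X₁ → X₀`. Products of complexes of abelian groups are exact, and the limit of
the tower in the derived category is the fiber of this map. -/
def oneSubShift (X : ℕ → ChainComplex AddCommGrpCat.{u} ℕ) (f : ∀ n, X (n + 1) ⟶ X n) :
    ∏ᶜ X ⟶ ∏ᶜ X :=
  𝟙 (∏ᶜ X) - Pi.lift fun n => Pi.π X (n + 1) ≫ f n

/-- The filtration `⋯ → X₂ → X₁ → X₀` is complete if its limit in the derived category
vanishes, i.e. if `1 - shift` is a quasi-isomorphism. -/
def IsCompleteTower (X : ℕ → ChainComplex AddCommGrpCat.{u} ℕ) (f : ∀ n, X (n + 1) ⟶ X n) : Prop :=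
  QuasiIso (oneSubShift X f)

end RealHochschild

end

/-!
# Connectivity of the powers of the exterior ideal

For a polynomial algebra `B = k[xᵢ]` over a ring `k` with `2 = 0`, the ring `C = B ⊗_{B⁽¹⁾} B` is an
exterior algebra over `B` on the elements `εᵢ = 1 ⊗ xᵢ - xᵢ ⊗ 1`, and `J = (εᵢ)`. The only facts about
this situation which are used are that `εᵢ² = 0` and that there are derivations `∂ᵢ` of `C` with
`∂ᵢ εⱼ = δᵢⱼ`, namely `∂ᵢ = id ⊗ ∂/∂xᵢ` (`exteriorCoordinates`).

Let `S` be a pointed set with a map `f : S → J` onto `J` which sends the base point to `0`, let `X` be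
the `F₂`-vector space on `S` modulo the base point, and let `Γᵖ` denote divided powers. There is a
Koszul complex
`⋯ → Jⁿ⁻² ⊗ Γ²X → Jⁿ⁻¹ ⊗ X → Jⁿ → 0`,
whose differential multiplies a divided power variable `s` into the coefficient as `f s`. It is exact
at `Jⁿ⁻ᵖ ⊗ ΓᵖX` for `0 ≤ p < n` (`Koszul.exists_contract_eq`): in the letters `s` with `f s = εᵢ` a
contracting homotopy is given by `∂ᵢ` followed by raising the exponent of `s`, and the remaining
letters are eliminated by induction on `p` (`Koszul.exists_diff_eq_union`).

Now let everything be simplicial, and take for `S` the space of paths in `J` which start at `0`,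
`Sₘ = {y ∈ Jₘ₊₁ | y vanishes at the vertex 0}`, with `f` the face opposite to that vertex. If
`π₀ J = 0`, then `f` is surjective in every degree (`SimplicialIdeal.pathEnd_surjective`), so the
Koszul complexes form a resolution of `Jⁿ`. As `S` contracts to its base point,
`Jⁿ⁻ᵖ ⊗ ΓᵖX` is acyclic for every `p ≥ 1` (`SimplicialIdeal.isZero_homology_koszul`). A diagram chase
(`exists_d_comp_eq`) then gives `πᵢ (Jⁿ) = 0` for `i < n`
(`SimplicialIdeal.isConnectedUpTo_pow`).

Completeness is formal: in a fixed degree `i` the homology of `Jⁿ` vanishes for all `n > i`, so the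
equations `xₙ - xₙ₊₁ = yₙ` can be solved in homology, uniquely, by descending recursion on `n`
(`isCompleteTower_of_isConnectedUpTo`).
-/

noncomputable section

namespace RealHochschild

/-! ### The Koszul complex of an exterior ideal -/

/-- Exterior coordinates on an ideal `J`: generators `εᵢ` of square zero, together with derivations
`∂ᵢ` such that `∂ᵢ εⱼ = δᵢⱼ`. If `C` is an exterior algebra over a subring `B` and `J` is generated by
the exterior variables, then `∂ᵢ` is the contraction with the `i`-th dual variable. Linearity of `∂ᵢ`
over `B` plays no role. -/
structure ExteriorCoordinates {C : Type*} [CommRing C] (J : Ideal C) (σ : Type*) where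
  /-- the generators `εᵢ` -/
  coord : σ → C
  span_coord : Ideal.span (Set.range coord) = J
  coord_mul_self : ∀ i, coord i * coord i = 0
  /-- the derivations `∂ᵢ` -/
  deriv : σ → Derivation ℤ C C
  deriv_self : ∀ i, deriv i (coord i) = 1
  deriv_ne : ∀ i j, i ≠ j → deriv i (coord j) = 0

namespace Koszul

open scoped Classical in
/-- The Koszul differential `y ↦ ∑ₛ f s • ∂y/∂s` on divided powers in the letters `s ∈ A` with
coefficients in `C`. The element `∑ₘ v m • y^{[m]}`, where `y^{[m]}` is the monomial of divided powers
with the multiset `m` of letters, is encoded by its coefficient function `v`. Here `v` need not have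
finite support, and the sum is over the finite set `A` of letters that occur. -/
def diff {C S : Type*} [CommRing C] (f : S → C) (A : Finset S) (v : Multiset S → C) :
    Multiset S → C :=
  fun m => ∑ s ∈ A, f s * v (s ::ₘ m)

open scoped Classical in
/-- The operation `y^{[m]} ↦ y^{[m + s]}` on divided powers: it raises the exponent of `s` by one. -/
def raise {C S : Type*} [CommRing C] (s : S) (v : Multiset S → C) : Multiset S → C :=
  fun m => if s ∈ m then v (m.erase s) else 0

/-- `v` is homogeneous of degree `p`, involves only letters in `A`, and has coefficients in `I`. -/
structure IsForm {C S : Type*} [CommRing C] (I : Ideal C) (A : Finset S) (p : ℕ)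
    (v : Multiset S → C) : Prop where
  mem : ∀ m, v m ∈ I
  card : ∀ m, v m ≠ 0 → m.card = p
  letters : ∀ m, v m ≠ 0 → ∀ s ∈ m, s ∈ A

variable {C S σ : Type*} [CommRing C]

theorem diff_sub (f : S → C) (A : Finset S) (v w : Multiset S → C) :
    diff f A (v - w) = diff f A v - diff f A w := by
  ext m; simp [diff, mul_sub, Finset.sum_sub_distrib]

theorem diff_add (f : S → C) (A : Finset S) (v w : Multiset S → C) :
    diff f A (v + w) = diff f A v + diff f A w := by
  ext m; simp [diff, mul_add, Finset.sum_add_distrib]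

/-- The terms for `(s, t)` and `(t, s)` cancel because `2 = 0`, the diagonal ones because
`f s * f s = 0`. -/
theorem diff_diff (h2 : (2 : C) = 0) (f : S → C) (A : Finset S)
    (hf : ∀ s ∈ A, f s * f s = 0) (v : Multiset S → C) : diff f A (diff f A v) = 0 := by
  ext m
  simp only [diff, Finset.mul_sum, Pi.zero_apply]
  rw [← Finset.sum_product']
  refine Finset.sum_involution (fun x _ => (x.2, x.1)) ?_ ?_ ?_ ?_
  · rintro ⟨s, t⟩ -
    have : f s * (f t * v (t ::ₘ s ::ₘ m)) + f t * (f s * v (s ::ₘ t ::ₘ m)) =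
      2 * (f s * (f t * v (t ::ₘ s ::ₘ m))) := by rw [Multiset.cons_swap s t]; ring
    simp [this, h2]
  · rintro ⟨s, t⟩ hs hne heq
    obtain rfl : t = s := congrArg Prod.fst heq
    refine hne ?_
    simp only
    rw [← mul_assoc, hf _ (Finset.mem_product.1 hs).1, zero_mul]
  · rintro ⟨s, t⟩ hs
    exact Finset.mem_product.2 (Finset.mem_product.1 hs).symm
  · rintro ⟨s, t⟩ -; rfl

theorem IsForm.diff {I I' : Ideal C} {A : Finset S} {p : ℕ} {f : S → C} {v : Multiset S → C}
    (hv : IsForm I A (p + 1) v) (hf : ∀ s ∈ A, ∀ c ∈ I, f s * c ∈ I') :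
    IsForm I' A p (diff f A v) where
  mem m := sum_mem fun s hs => hf s hs _ (hv.mem _)
  card m hm := by
    obtain ⟨s, -, hs⟩ := Finset.exists_ne_zero_of_sum_ne_zero hm
    simpa using hv.card _ (right_ne_zero_of_mul hs)
  letters m hm t ht := by
    obtain ⟨s, -, hs⟩ := Finset.exists_ne_zero_of_sum_ne_zero hm
    exact hv.letters _ (right_ne_zero_of_mul hs) t (Multiset.mem_cons_of_mem ht)

theorem IsForm.sub {I : Ideal C} {A : Finset S} {p : ℕ} {v w : Multiset S → C}
    (hv : IsForm I A p v) (hw : IsForm I A p w) : IsForm I A p (v - w) where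
  mem m := sub_mem (hv.mem m) (hw.mem m)
  card m hm := by
    by_cases h : v m = 0
    · exact hw.card m (by rintro h'; simp [h, h'] at hm)
    · exact hv.card m h
  letters m hm := by
    by_cases h : v m = 0
    · exact hw.letters m (by rintro h'; simp [h, h'] at hm)
    · exact hv.letters m h

theorem IsForm.add {I : Ideal C} {A : Finset S} {p : ℕ} {v w : Multiset S → C}
    (hv : IsForm I A p v) (hw : IsForm I A p w) : IsForm I A p (v + w) where
  mem m := add_mem (hv.mem m) (hw.mem m)
  card m hm := by
    by_cases h : v m = 0
    · exact hw.card m (by rintro h'; simp [h, h'] at hm)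
    · exact hv.card m h
  letters m hm := by
    by_cases h : v m = 0
    · exact hw.letters m (by rintro h'; simp [h, h'] at hm)
    · exact hv.letters m h

theorem IsForm.mono {I I' : Ideal C} {A A' : Finset S} {p : ℕ} {v : Multiset S → C}
    (hv : IsForm I A p v) (hI : I ≤ I') (hA : A ⊆ A') : IsForm I' A' p v :=
  ⟨fun m => hI (hv.mem m), hv.card, fun m hm s hs => hA (hv.letters m hm s hs)⟩

theorem IsForm.raise {I : Ideal C} {A : Finset S} {p : ℕ} {v : Multiset S → C}
    (hv : IsForm I A p v) {s : S} (hs : s ∈ A) : IsForm I A (p + 1) (raise s v) := by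
  classical
  refine ⟨fun m => ?_, fun m hm => ?_, fun m hm t ht => ?_⟩
  · by_cases h : s ∈ m
    · simpa [Koszul.raise, h] using hv.mem _
    · simp [Koszul.raise, h]
  · by_cases h : s ∈ m
    · have := hv.card (m.erase s) (by simpa [Koszul.raise, h] using hm)
      have h' := congrArg Multiset.card (Multiset.cons_erase h)
      rw [Multiset.card_cons] at h'
      omega
    · simp [Koszul.raise, h] at hm
  · by_cases h : s ∈ m
    · rw [← Multiset.cons_erase h, Multiset.mem_cons] at ht
      rcases ht with rfl | ht
      · exact hs
      · exact hv.letters (m.erase s) (by simpa [Koszul.raise, h] using hm) t ht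
    · simp [Koszul.raise, h] at hm

theorem deriv_mem_pow {J : Ideal C} (D : Derivation ℤ C C) (j : ℕ) :
    ∀ c ∈ J ^ (j + 1), D c ∈ J ^ j := by
  induction j with
  | zero => intro c _; simp
  | succ j ih =>
    intro c hc
    rw [pow_succ] at hc
    refine Submodule.mul_induction_on hc (fun x hx y hy => ?_) (fun x y hx hy => ?_)
    · rw [Derivation.leibniz, smul_eq_mul, smul_eq_mul]
      refine add_mem (Ideal.mul_mem_right _ _ hx) ?_
      rw [mul_comm, pow_succ]
      exact Ideal.mul_mem_mul (ih x hx) hy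
    · rw [map_add]; exact add_mem hx hy

variable {J : Ideal C} (E : ExteriorCoordinates J σ)

theorem coord_mem (i : σ) : E.coord i ∈ J := by
  exact E.span_coord.le (Ideal.subset_span ⟨i, rfl⟩)

/-- In characteristic two, all elements of `J` have square zero, since squaring is additive. -/
theorem mul_self_eq_zero_of_mem {J : Ideal C} (E : ExteriorCoordinates J σ) (h2 : (2 : C) = 0)
    {c : C} (hc : c ∈ J) : c * c = 0 := by
  replace hc := E.span_coord.ge hc
  induction hc using Submodule.span_induction with
  | mem x hx => obtain ⟨i, rfl⟩ := hx; exact E.coord_mul_self i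
  | zero => simp
  | add x y _ _ hx hy =>
    have : (x + y) * (x + y) = x * x + y * y + 2 * (x * y) := by ring
    rw [this, hx, hy, h2]; simp
  | smul a x _ hx =>
    have : (a • x) * (a • x) = a * a * (x * x) := by simp only [smul_eq_mul]; ring
    rw [this, hx, mul_zero]

/-- The ideal generated by finitely many of the coordinates. -/
def partialIdeal (F : Finset σ) : Ideal C := Ideal.span (E.coord '' F)

/-- The projection `c ↦ c - εᵢ ∂ᵢ c` sets `εᵢ` to zero. -/
theorem sub_mem_partialIdeal [DecidableEq σ] {F : Finset σ} {i : σ} {c : C}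
    (hc : c ∈ partialIdeal E (insert i F)) :
    c - E.coord i * E.deriv i c ∈ partialIdeal E F := by
  unfold partialIdeal at hc
  induction hc using Submodule.span_induction with
  | mem x hx =>
    obtain ⟨j, hj, rfl⟩ := hx
    by_cases h : i = j
    · subst h; rw [E.deriv_self]; simp
    · rw [E.deriv_ne i j h, mul_zero, sub_zero]
      refine Ideal.subset_span ⟨j, ?_, rfl⟩
      rcases Finset.mem_insert.1 (Finset.mem_coe.1 hj) with h' | h'
      · exact absurd h'.symm h
      · exact h'
  | zero => simp
  | add x y _ _ hx hy =>
    have := add_mem hx hy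
    convert this using 1
    rw [map_add]; ring
  | smul a x hxm hx =>
    have key : x * E.coord i ∈ partialIdeal E F := by
      clear hx
      induction hxm using Submodule.span_induction with
      | mem x hx =>
        obtain ⟨j, hj, rfl⟩ := hx
        by_cases h : i = j
        · subst h; rw [E.coord_mul_self]; simp
        · refine Ideal.mul_mem_right _ _ (Ideal.subset_span ⟨j, ?_, rfl⟩)
          rcases Finset.mem_insert.1 (Finset.mem_coe.1 hj) with h' | h'
          · exact absurd h'.symm h
          · exact h'
      | zero => simp
      | add x y _ _ hx hy => rw [add_mul]; exact add_mem hx hy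
      | smul a x _ hx => rw [smul_eq_mul, mul_assoc]; exact Ideal.mul_mem_left _ _ hx
    have : a • x - E.coord i * E.deriv i (a • x) =
        a * (x - E.coord i * E.deriv i x) - E.deriv i a * (x * E.coord i) := by
      simp only [smul_eq_mul, Derivation.leibniz]; ring
    rw [this]
    exact sub_mem (Ideal.mul_mem_left _ _ hx) (Ideal.mul_mem_left _ _ key)

theorem partialIdeal_mono {F F' : Finset σ} (h : F ⊆ F') : partialIdeal E F ≤ partialIdeal E F' :=
  Ideal.span_mono (Set.image_mono (Finset.coe_subset.2 h))

theorem exists_mem_partialIdeal {c : C} (hc : c ∈ J) : ∃ F, c ∈ partialIdeal E F := by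
  classical
  replace hc := E.span_coord.ge hc
  induction hc using Submodule.span_induction with
  | mem x hx =>
    obtain ⟨i, rfl⟩ := hx
    exact ⟨{i}, Ideal.subset_span ⟨i, by simp, rfl⟩⟩
  | zero => exact ⟨∅, zero_mem _⟩
  | add x y _ _ hx hy =>
    obtain ⟨F, hF⟩ := hx
    obtain ⟨F', hF'⟩ := hy
    exact ⟨F ∪ F', add_mem (partialIdeal_mono E Finset.subset_union_left hF)
      (partialIdeal_mono E Finset.subset_union_right hF')⟩
  | smul a x _ hx =>
    obtain ⟨F, hF⟩ := hx
    exact ⟨F, Ideal.mul_mem_left _ _ hF⟩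

theorem exists_forall_mem_partialIdeal (s : Finset C) (hs : ∀ c ∈ s, c ∈ J) :
    ∃ F, ∀ c ∈ s, c ∈ partialIdeal E F := by
  classical
  induction s using Finset.induction_on with
  | empty => exact ⟨∅, by simp⟩
  | insert a s _ ih =>
    obtain ⟨F, hF⟩ := ih fun c hc => hs c (Finset.mem_insert_of_mem hc)
    obtain ⟨F', hF'⟩ := exists_mem_partialIdeal E (hs a (Finset.mem_insert_self a s))
    refine ⟨F ∪ F', fun c hc => ?_⟩
    rcases Finset.mem_insert.1 hc with rfl | hc
    · exact partialIdeal_mono E Finset.subset_union_right hF'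
    · exact partialIdeal_mono E Finset.subset_union_left (hF c hc)

/-- With `h = ∂ᵢ ∘ raise s`, where `s` is the letter of `εᵢ`, the operator `1 - (d h + h d)` sets both
`εᵢ` and `s` to zero. The statement is about cycles, so that `h d` does not appear. -/
theorem sub_diff_deriv_raise (h2 : (2 : C) = 0) (f : S → C) (ι : σ ↪ S)
    (hι : ∀ i, f (ι i) = E.coord i) (G : Finset σ) {i : σ} (hi : i ∈ G) (v : Multiset S → C)
    (hv : diff f (G.map ι) v = 0) (m : Multiset S) [Decidable (ι i ∈ m)] :
    v m - diff f (G.map ι) (fun m => E.deriv i (raise (ι i) v m)) m =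
      if ι i ∈ m then 0 else v m - E.coord i * E.deriv i (v m) := by
  classical
  have hself : raise (ι i) v (ι i ::ₘ m) = v m := by simp [raise]
  have hrest : ∀ k ∈ G.erase i, raise (ι i) v (ι k ::ₘ m) =
      if ι i ∈ m then v (ι k ::ₘ m.erase (ι i)) else 0 := by
    intro k hk
    have hne : ι i ≠ ι k := fun h => Finset.ne_of_mem_erase hk (ι.injective h).symm
    simp only [raise, Multiset.mem_cons, hne, false_or]
    rw [Multiset.erase_cons_tail _ hne.symm]
  simp only [diff, Finset.sum_map, hι]
  rw [← Finset.add_sum_erase _ _ hi, hself, Finset.sum_congr rfl fun k hk => by rw [hrest k hk]]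
  split_ifs with hmem
  · have h := congrArg (E.deriv i) (congrFun hv (m.erase (ι i)))
    simp only [diff, Finset.sum_map, hι, Pi.zero_apply, map_zero, map_sum] at h
    rw [← Finset.add_sum_erase _ _ hi, Multiset.cons_erase hmem] at h
    have hk : ∀ k ∈ G.erase i, E.deriv i (E.coord k * v (ι k ::ₘ m.erase (ι i))) =
        E.coord k * E.deriv i (v (ι k ::ₘ m.erase (ι i))) := by
      intro k hk
      rw [Derivation.leibniz, E.deriv_ne i k (Finset.ne_of_mem_erase hk).symm]
      simp
    rw [Finset.sum_congr rfl hk, Derivation.leibniz, E.deriv_self] at h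
    simp only [smul_eq_mul, mul_one] at h
    linear_combination -h + v m * h2
  · simp

/-- Exactness of the Koszul complex when all letters correspond to coordinates: by
`sub_diff_deriv_raise` the coordinates can be removed from the coefficients of a cycle one after the
other, without changing its class. As the coefficients lie in `J`, they are then zero. -/
theorem exists_diff_eq_of_coordinates (h2 : (2 : C) = 0) (f : S → C) (ι : σ ↪ S)
    (hι : ∀ i, f (ι i) = E.coord i) (G : Finset σ) (p j : ℕ) (F : Finset σ) (hF : F ⊆ G)
    (v : Multiset S → C) (hv : IsForm (J ^ (j + 1)) (G.map ι) p v)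
    (hvF : ∀ m, v m ∈ partialIdeal E F) (hd : diff f (G.map ι) v = 0) :
    ∃ w, IsForm (J ^ j) (G.map ι) (p + 1) w ∧ diff f (G.map ι) w = v := by
  classical
  have hfJ : ∀ s ∈ G.map ι, f s ∈ J := by
    intro s hs
    obtain ⟨i, -, rfl⟩ := Finset.mem_map.1 hs
    rw [hι]; exact coord_mem E i
  induction F using Finset.induction_on generalizing v with
  | empty =>
    have : v = 0 := by ext m; simpa [partialIdeal] using hvF m
    subst this
    exact ⟨0, ⟨by simp, by simp, by simp⟩, by ext; simp [diff]⟩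
  | insert i F _ ih =>
    have hi : i ∈ G := hF (Finset.mem_insert_self i F)
    set h : Multiset S → C := fun m => E.deriv i (raise (ι i) v m) with hh
    have hr := hv.raise (Finset.mem_map_of_mem ι hi)
    have hform : IsForm (J ^ j) (G.map ι) (p + 1) h :=
      ⟨fun m => deriv_mem_pow _ _ _ (hr.mem m),
        fun m hm => hr.card m fun h0 => hm (by simp [hh, h0]),
        fun m hm => hr.letters m fun h0 => hm (by simp [hh, h0])⟩
    have hdh : IsForm (J ^ (j + 1)) (G.map ι) p (diff f (G.map ι) h) :=
      hform.diff fun s hs c hc => by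
        rw [pow_succ']; exact Ideal.mul_mem_mul (hfJ s hs) hc
    obtain ⟨w, hw, hwv⟩ := ih (fun x hx => hF (Finset.mem_insert_of_mem hx))
      (v - diff f (G.map ι) h) (hv.sub hdh)
      (fun m => by
        rw [Pi.sub_apply, sub_diff_deriv_raise E h2 f ι hι G hi v hd m]
        split_ifs
        · exact zero_mem _
        · exact sub_mem_partialIdeal E (hvF m))
      (by rw [diff_sub, hd, diff_diff h2 f _ fun s hs => mul_self_eq_zero_of_mem E h2 (hfJ s hs),
            sub_zero])
    exact ⟨w + h, hw.add hform, by rw [diff_add, hwv, sub_add_cancel]⟩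

/-- Exactness of the Koszul complex in the letters of the coordinates and finitely many other letters
`y`. For a cycle `v` of degree `p`, the derivative `∂v/∂y` is a cycle of degree `p - 1`, hence a
boundary `d w` by induction on `p`; subtracting `d (raise y w)` from `v` removes the letter `y`. -/
theorem exists_diff_eq_union (h2 : (2 : C) = 0) (f : S → C) (hfJ : ∀ s, f s ∈ J) (ι : σ ↪ S)
    (hι : ∀ i, f (ι i) = E.coord i) (G : Finset σ) [DecidableEq S] (Y : Finset S)
    (hY : ∀ s ∈ Y, f s ∈ partialIdeal E G) (p j : ℕ)
    (v : Multiset S → C) (hv : IsForm (J ^ (j + 1)) (Y ∪ G.map ι) p v)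
    (hvG : ∀ m, v m ∈ partialIdeal E G) (hd : diff f (Y ∪ G.map ι) v = 0) :
    ∃ w, IsForm (J ^ j) (Y ∪ G.map ι) (p + 1) w ∧ diff f (Y ∪ G.map ι) w = v := by
  induction Y using Finset.induction_on generalizing p j v with
  | empty =>
    rw [Finset.empty_union] at *
    exact exists_diff_eq_of_coordinates E h2 f ι hι G p j G subset_rfl v hv hvG hd
  | insert y Y hy ihY =>
    rw [Finset.insert_union] at *
    set A := Y ∪ G.map ι with hA
    by_cases hyA : y ∈ A
    · rw [Finset.insert_eq_of_mem hyA] at *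
      exact ihY (fun s hs => hY s (Finset.mem_insert_of_mem hs)) p j v hv hvG hd
    have hfG : ∀ s ∈ insert y A, f s ∈ partialIdeal E G := by
      intro s hs
      rw [hA, ← Finset.insert_union] at hs
      rcases Finset.mem_union.1 hs with hs | hs
      · exact hY s hs
      · obtain ⟨i, hi, rfl⟩ := Finset.mem_map.1 hs
        rw [hι]; exact Ideal.subset_span ⟨i, hi, rfl⟩
    -- it suffices to treat functions that do not involve the letter `y`
    have red : ∀ (p j : ℕ) (v : Multiset S → C), IsForm (J ^ (j + 1)) (insert y A) p v →
        (∀ m, v m ∈ partialIdeal E G) → diff f (insert y A) v = 0 → (∀ m, v (y ::ₘ m) = 0) →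
        ∃ w, IsForm (J ^ j) (insert y A) (p + 1) w ∧ diff f (insert y A) w = v := by
      intro p j v hv hvG hd hvy
      have hform : IsForm (J ^ (j + 1)) A p v := by
        refine ⟨hv.mem, hv.card, fun m hm s hs => ?_⟩
        refine Finset.mem_of_mem_insert_of_ne (hv.letters m hm s hs) ?_
        rintro rfl
        rw [← Multiset.cons_erase hs] at hm
        exact hm (hvy _)
      obtain ⟨w, hw, hwv⟩ := ihY (fun s hs => hY s (Finset.mem_insert_of_mem hs)) p j v hform hvG
        (by
          ext m
          have := congrFun hd m
          simpa [diff, Finset.sum_insert hyA, hvy] using this)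
      refine ⟨w, hw.mono le_rfl (Finset.subset_insert y A), ?_⟩
      ext m
      rw [← hwv]
      have h0 : w (y ::ₘ m) = 0 := by
        by_contra h
        exact hyA (hw.letters _ h y (Multiset.mem_cons_self y m))
      simp [diff, Finset.sum_insert hyA, h0]
    induction p generalizing j v with
    | zero =>
      refine red 0 j v hv hvG hd fun m => ?_
      by_contra h
      simpa using hv.card _ h
    | succ p ihp =>
      have hform : IsForm (J ^ (j + 1)) (insert y A) p fun m => v (y ::ₘ m) :=
        ⟨fun m => hv.mem _, fun m hm => by simpa using hv.card _ hm,
          fun m hm s hs => hv.letters _ hm s (Multiset.mem_cons_of_mem hs)⟩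
      obtain ⟨w, hw, hwv⟩ := ihp (j := j) (v := fun m => v (y ::ₘ m)) (hv := hform)
        (hvG := fun m => hvG _) (hd := by
          ext m
          have := congrFun hd (y ::ₘ m)
          simpa only [diff, Multiset.cons_swap y, Pi.zero_apply] using this)
      have hyA' := Finset.mem_insert_self y A
      have hr : ∀ m, diff f (insert y A) (raise y w) (y ::ₘ m) = v (y ::ₘ m) := by
        intro m
        rw [← congrFun hwv m]
        refine Finset.sum_congr rfl fun s _ => ?_
        rw [Multiset.cons_swap]
        simp [raise]
      obtain ⟨w', hw', hwv'⟩ := red (p + 1) j (v - diff f (insert y A) (raise y w))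
        (hv.sub ((hw.raise hyA').diff fun s _ c hc => by
          rw [pow_succ']; exact Ideal.mul_mem_mul (hfJ s) hc))
        (fun m => sub_mem (hvG m) (sum_mem fun s hs => Ideal.mul_mem_right _ _ (hfG s hs)))
        (by rw [diff_sub, hd,
              diff_diff h2 f _ fun s _ => mul_self_eq_zero_of_mem E h2 (hfJ s), sub_zero])
        (fun m => by rw [Pi.sub_apply, hr, sub_self])
      exact ⟨w' + raise y w, hw'.add (hw.raise hyA'), by rw [diff_add, hwv', sub_add_cancel]⟩

/-- Exactness of the Koszul complex of a surjection `f : S → J`. The primitive may involve more letters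
than `v` does. -/
theorem exists_diff_eq {J : Ideal C} (E : ExteriorCoordinates J σ) (h2 : (2 : C) = 0) (f : S → C) (hfJ : ∀ s, f s ∈ J)
    (hf : ∀ c ∈ J, ∃ s, f s = c) (A : Finset S) (p j : ℕ)
    (v : Multiset S → C) (hv : IsForm (J ^ (j + 1)) A p v) (hfin : (Set.range v).Finite)
    (hd : diff f A v = 0) :
    ∃ (B : Finset S) (w : Multiset S → C), IsForm (J ^ j) B (p + 1) w ∧ diff f B w = v := by
  classical
  cases subsingleton_or_nontrivial C with
  | inl _ =>
    exact ⟨∅, 0, ⟨by simp, by simp, by simp⟩, Subsingleton.elim _ _⟩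
  | inr _ =>
  -- choose a letter for every coordinate
  choose ι hι using fun i => hf _ (coord_mem E i)
  have hinj : Function.Injective ι := by
    intro i j hij
    by_contra hne
    have h := congrArg (E.deriv i) ((hι i).symm.trans ((congrArg f hij).trans (hι j)))
    rw [E.deriv_self, E.deriv_ne i j hne] at h
    exact one_ne_zero h
  -- finitely many coordinates suffice for the coefficients of `v` and for the values of `f` on `A`
  obtain ⟨G, hG⟩ := exists_forall_mem_partialIdeal E (A.image f ∪ hfin.toFinset) (by
    intro c hc
    rcases Finset.mem_union.1 hc with hc | hc
    · obtain ⟨s, -, rfl⟩ := Finset.mem_image.1 hc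
      exact hfJ s
    · obtain ⟨m, rfl⟩ := hfin.mem_toFinset.1 hc
      exact Ideal.pow_le_self j.succ_ne_zero (hv.mem m))
  refine ⟨A ∪ G.map ⟨ι, hinj⟩, exists_diff_eq_union E h2 f hfJ ⟨ι, hinj⟩ hι G A
    (fun s hs => hG _ (Finset.mem_union_left _ (Finset.mem_image_of_mem f hs))) p j v
    (hv.mono le_rfl Finset.subset_union_left)
    (fun m => hG _ (Finset.mem_union_right _ (hfin.mem_toFinset.2 ⟨m, rfl⟩))) ?_⟩
  -- enlarging the set of letters does not change the differential of `v`
  rw [← hd]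
  ext m
  refine (Finset.sum_subset Finset.subset_union_left fun s _ hs => ?_).symm
  by_contra h
  exact hs (hv.letters _ (right_ne_zero_of_mul h) s (Multiset.mem_cons_self s m))

/-! ### Symmetric tensors as functions on words

The functoriality of divided powers in maps of letters involves multinomial coefficients in the basis
of monomials. It becomes transparent when `Γᵖ` is regarded as the group of symmetric tensors, i.e. of
symmetric functions with finite support on words of length `p`.
-/

/-- Exchange the letters in positions `k` and `k + 1` of a word (if there are such). -/
def swapAt {S : Type*} : ℕ → List S → List S
  | 0, a :: b :: l => b :: a :: l
  | k + 1, a :: l => a :: swapAt k l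
  | 0, [] => []
  | 0, [a] => [a]
  | _ + 1, [] => []

section Words

variable {S S' S'' : Type*}

theorem swapAt_involutive (k : ℕ) : Function.Involutive (swapAt (S := S) k) := by
  intro l
  induction k generalizing l with
  | zero => rcases l with _ | ⟨a, _ | ⟨b, l⟩⟩ <;> rfl
  | succ k ih => rcases l with _ | ⟨a, l⟩ <;> simp [swapAt, ih]

theorem map_swapAt (φ : S → S') (k : ℕ) (l : List S) :
    (swapAt k l).map φ = swapAt k (l.map φ) := by
  induction k generalizing l with
  | zero => rcases l with _ | ⟨a, _ | ⟨b, l⟩⟩ <;> rfl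
  | succ k ih => rcases l with _ | ⟨a, l⟩ <;> simp [swapAt, ih]

theorem swapAt_perm (k : ℕ) (l : List S) : (swapAt k l).Perm l := by
  induction k generalizing l with
  | zero =>
    rcases l with _ | ⟨a, _ | ⟨b, l⟩⟩
    · rfl
    · rfl
    · exact List.Perm.swap a b l
  | succ k ih =>
    rcases l with _ | ⟨a, l⟩
    · rfl
    · exact (ih l).cons a

theorem swapAt_append (pre : List S) (a b : S) (l : List S) :
    swapAt pre.length (pre ++ a :: b :: l) = pre ++ b :: a :: l := by
  induction pre with
  | nil => rfl
  | cons c pre ih => simp [swapAt, ih]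

theorem eq_of_perm {α : Type*} {v : List S → α} (hv : ∀ k l, v (swapAt k l) = v l)
    {l l' : List S} (h : l.Perm l') : v l = v l' := by
  suffices ∀ pre : List S, v (pre ++ l) = v (pre ++ l') from this []
  induction h with
  | nil => intro; rfl
  | cons a _ ih => intro pre; simpa using ih (pre ++ [a])
  | swap a b l => intro pre; rw [← swapAt_append, hv]
  | trans _ _ ih ih' => intro pre; exact (ih pre).trans (ih' pre)

variable {C C' C'' : Type*} [CommRing C] [CommRing C'] [CommRing C'']

/-- The action of `swapAt k` on functions with finite support on words. -/
def swapHom (C : Type*) [CommRing C] (S : Type*) (k : ℕ) : (List S →₀ C) →+ (List S →₀ C) :=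
  Finsupp.mapDomain.addMonoidHom (swapAt k)

theorem swapHom_apply (k : ℕ) (v : List S →₀ C) (l : List S) :
    swapHom C S k v l = v (swapAt k l) :=
  Finsupp.mapDomain_equiv_apply (f := (swapAt_involutive k).toPerm) v l

theorem swapHom_single (k : ℕ) (l : List S) (c : C) :
    swapHom C S k (Finsupp.single l c) = Finsupp.single (swapAt k l) c :=
  Finsupp.mapDomain_single

/-- Contraction of the first letter with `f : S → C`, that is `v ↦ (l ↦ ∑ₛ f s * v (s :: l))`. On symmetric
functions this is the Koszul differential. -/
def contract (f : S → C) : (List S →₀ C) →+ (List S →₀ C) :=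
  Finsupp.liftAddHom fun
    | [] => 0
    | s :: l => (Finsupp.singleAddHom l).comp (AddMonoidHom.mulLeft (f s))

@[simp]
theorem contract_single_nil (f : S → C) (c : C) : contract f (Finsupp.single [] c) = 0 := by
  simp [contract]

@[simp]
theorem contract_single_cons (f : S → C) (s : S) (l : List S) (c : C) :
    contract f (Finsupp.single (s :: l) c) = Finsupp.single l (f s * c) := by
  simp [contract]

/-- The coefficients of a contraction, as a sum over any finite set that contains all first letters
of words in the support. -/
theorem contract_apply (f : S → C) (v : List S →₀ C) (A : Finset S)
    (hA : ∀ s l, v (s :: l) ≠ 0 → s ∈ A) (l : List S) :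
    contract f v l = ∑ s ∈ A, f s * v (s :: l) := by
  classical
  have hinj : Function.Injective fun s : S => s :: l := fun s t h => (List.cons.inj h).1
  have h1 : contract f v l = ∑ l' ∈ v.support, contract f (Finsupp.single l' (v l')) l := by
    conv_lhs => rw [← Finsupp.sum_single v, Finsupp.sum, map_sum, Finsupp.finsetSum_apply]
  have hzero : ∀ l' : List S, (∀ s, l' ≠ s :: l) → ∀ c, contract f (Finsupp.single l' c) l = 0 := by
    rintro (_ | ⟨s, l'⟩) h c
    · simp
    · have : l' ≠ l := fun h' => h s (by rw [h'])
      simp [this]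
  rw [h1, ← Finset.sum_subset (Finset.subset_union_left (s₂ := A.map ⟨_, hinj⟩)) (f := fun l' =>
      contract f (Finsupp.single l' (v l')) l) (fun l' _ h => by simp [Finsupp.notMem_support_iff.1 h]) |>.symm,
    ← Finset.sum_subset (Finset.subset_union_right (s₁ := v.support)) (f := fun l' =>
      contract f (Finsupp.single l' (v l')) l) ?_]
  · simp
  · intro l' hl' hA'
    refine hzero l' (fun s hs => ?_) _
    subst hs
    have : s :: l ∈ v.support := (Finset.mem_union.1 hl').resolve_right hA'
    exact hA' (Finset.mem_map_of_mem ⟨_, hinj⟩ (hA s l (Finsupp.mem_support_iff.1 this)))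

theorem swapHom_contract (f : S → C) (k : ℕ) (v : List S →₀ C) :
    swapHom C S k (contract f v) = contract f (swapHom C S (k + 1) v) := by
  suffices (swapHom C S k).comp (contract f) = (contract f).comp (swapHom C S (k + 1)) from
    DFunLike.congr_fun this v
  refine Finsupp.addHom_ext fun l c => ?_
  rcases l with _ | ⟨s, l⟩
  · simp [swapHom_single, swapAt]
  · simp [swapHom_single, swapAt, -Finsupp.single_mul]

/-- The terms of two words that differ by an exchange of the first two letters cancel. -/
theorem contract_contract (h2 : (2 : C) = 0) (f : S → C) (hf : ∀ s, f s * f s = 0)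
    (v : List S →₀ C) (hv : ∀ l, v (swapAt 0 l) = v l) : contract f (contract f v) = 0 := by
  conv_lhs => rw [← Finsupp.sum_single v, Finsupp.sum, map_sum, map_sum]
  refine Finset.sum_involution (fun l _ => swapAt 0 l) ?_ ?_ ?_ ?_
  · intro l _
    rcases l with _ | ⟨s, _ | ⟨t, l⟩⟩
    · simp [swapAt]
    · simp [swapAt, -Finsupp.single_mul]
    · have := hv (s :: t :: l)
      simp only [swapAt] at this ⊢
      simp only [contract_single_cons, this, ← Finsupp.single_add]
      rw [show f t * (f s * v (s :: t :: l)) + f s * (f t * v (s :: t :: l)) =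
        2 * (f t * (f s * v (s :: t :: l))) by ring, h2, zero_mul, Finsupp.single_zero]
  · intro l _ hne heq
    rcases l with _ | ⟨s, _ | ⟨t, l⟩⟩
    · simp at hne
    · simp [-Finsupp.single_mul] at hne
    · obtain rfl : t = s := (List.cons.inj heq).1
      simp [← mul_assoc, hf, -Finsupp.single_mul] at hne
  · intro l hl
    simpa [hv] using hl
  · intro l _
    exact swapAt_involutive 0 l

theorem exists_letters (v : List S →₀ C) : ∃ A : Finset S, ∀ l, v l ≠ 0 → ∀ s ∈ l, s ∈ A := by
  classical
  exact ⟨v.support.biUnion List.toFinset, fun l hl s hs =>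
    Finset.mem_biUnion.2 ⟨l, Finsupp.mem_support_iff.2 hl, List.mem_toFinset.2 hs⟩⟩

variable [Zero S']

open scoped Classical in
/-- Push-forward along `g` on coefficients and along `φ` on letters, where `0` is the base point of
`S'`: words with a letter that maps to the base point are sent to zero. -/
def push (g : C →+* C') (φ : S → S') : (List S →₀ C) →+ (List S' →₀ C') :=
  Finsupp.liftAddHom fun l =>
    if 0 ∈ l.map φ then 0 else (Finsupp.singleAddHom (l.map φ)).comp g.toAddMonoidHom

theorem push_single_of_mem (g : C →+* C') (φ : S → S') {l : List S} (h : 0 ∈ l.map φ) (c : C) :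
    push g φ (Finsupp.single l c) = 0 := by
  simp only [push, Finsupp.liftAddHom_apply_single, if_pos h, AddMonoidHom.zero_apply]

theorem push_single_of_notMem (g : C →+* C') (φ : S → S') {l : List S} (h : 0 ∉ l.map φ) (c : C) :
    push g φ (Finsupp.single l c) = Finsupp.single (l.map φ) (g c) := by
  simp only [push, Finsupp.liftAddHom_apply_single, if_neg h]
  rfl

theorem swapHom_push (g : C →+* C') (φ : S → S') (k : ℕ) (v : List S →₀ C) :
    swapHom C' S' k (push g φ v) = push g φ (swapHom C S k v) := by
  suffices (swapHom C' S' k).comp (push g φ) = (push g φ).comp (swapHom C S k) from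
    DFunLike.congr_fun this v
  refine Finsupp.addHom_ext fun l c => ?_
  simp only [AddMonoidHom.comp_apply, swapHom_single]
  have hiff : 0 ∈ (swapAt k l).map φ ↔ 0 ∈ l.map φ := by
    rw [map_swapAt]; exact (swapAt_perm _ _).mem_iff
  by_cases h : 0 ∈ l.map φ
  · rw [push_single_of_mem _ _ h, push_single_of_mem _ _ (hiff.2 h), map_zero]
  · rw [push_single_of_notMem _ _ h, push_single_of_notMem _ _ (fun h' => h (hiff.1 h')),
      swapHom_single, map_swapAt]

variable [Zero S'']

theorem push_comp (g : C →+* C') (φ : S → S') (g' : C' →+* C'') (φ' : S' → S'') (hφ' : φ' 0 = 0)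
    (v : List S →₀ C) : push (g'.comp g) (φ' ∘ φ) v = push g' φ' (push g φ v) := by
  suffices push (g'.comp g) (φ' ∘ φ) = (push g' φ').comp (push g φ) from
    DFunLike.congr_fun this v
  refine Finsupp.addHom_ext fun l c => ?_
  simp only [AddMonoidHom.comp_apply]
  by_cases h : 0 ∈ l.map φ
  · rw [push_single_of_mem _ _ h, map_zero, push_single_of_mem]
    obtain ⟨s, hs, h0⟩ := List.mem_map.1 h
    exact List.mem_map.2 ⟨s, hs, by simp [h0, hφ']⟩
  · rw [push_single_of_notMem _ _ h]
    by_cases h' : 0 ∈ (l.map φ).map φ'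
    · rw [push_single_of_mem _ _ h', push_single_of_mem]
      simpa using h'
    · rw [push_single_of_notMem _ _ h', push_single_of_notMem]
      · simp
      · simpa using h'

theorem contract_push (g : C →+* C') (φ : S → S') (f : S → C) (f' : S' → C') (hf' : f' 0 = 0)
    (h : ∀ s, f' (φ s) = g (f s)) (v : List S →₀ C) :
    contract f' (push g φ v) = push g φ (contract f v) := by
  suffices (contract f').comp (push g φ) = (push g φ).comp (contract f) from
    DFunLike.congr_fun this v
  refine Finsupp.addHom_ext fun l c => ?_
  simp only [AddMonoidHom.comp_apply]
  rcases l with _ | ⟨s, l⟩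
  · rw [push_single_of_notMem _ _ (by simp)]; simp
  · rw [contract_single_cons]
    by_cases hl : 0 ∈ l.map φ
    · rw [push_single_of_mem _ _ hl, push_single_of_mem _ _ (by simp at hl ⊢; exact Or.inr hl),
        map_zero]
    · rw [push_single_of_notMem _ _ hl]
      by_cases hs : φ s = 0
      · rw [push_single_of_mem _ _ (by simp [hs]), map_zero, map_mul, ← h, hs, hf', zero_mul,
          Finsupp.single_zero]
      · rw [push_single_of_notMem]
        · simp [h]
        · simp at hl ⊢; exact ⟨fun h => hs h.symm, hl⟩

variable [Zero S]

/-- The group `I ⊗ Γᵖ(F₂[S] / F₂[0])`, for an ideal `I` of a ring of characteristic two and a set `S`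
with base point `0`: symmetric functions with finite support on words of length `p` in the letters
`S ∖ {0}` with values in `I`. -/
def forms (S : Type*) [Zero S] (I : Ideal C) (p : ℕ) : AddSubgroup (List S →₀ C) where
  carrier := {v | (∀ k, swapHom C S k v = v) ∧ (∀ l, v l ∈ I) ∧
    (∀ l, v l ≠ 0 → l.length = p ∧ 0 ∉ l)}
  zero_mem' := ⟨by simp, by simp, by simp⟩
  add_mem' := by
    rintro v w ⟨hv, hv', hv''⟩ ⟨hw, hw', hw''⟩
    refine ⟨fun k => by rw [map_add, hv, hw], fun l => add_mem (hv' l) (hw' l), fun l hl => ?_⟩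
    by_cases h : v l = 0
    · exact hw'' l (by rintro h'; simp [h, h'] at hl)
    · exact hv'' l h
  neg_mem' := by
    rintro v ⟨hv, hv', hv''⟩
    exact ⟨fun k => by rw [map_neg, hv], fun l => neg_mem (hv' l),
      fun l hl => hv'' l (by simpa using hl)⟩

variable {I : Ideal C} {p : ℕ} {v : List S →₀ C}

theorem apply_swapAt_of_mem_forms (hv : v ∈ forms S I p) (k : ℕ) (l : List S) :
    v (swapAt k l) = v l := by
  rw [← swapHom_apply, hv.1]

theorem push_mem_forms {I' : Ideal C'} (g : C →+* C') (φ : S → S') (hI : I ≤ I'.comap g)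
    (hv : v ∈ forms S I p) : push g φ v ∈ forms S' I' p := by
  classical
  have key : ∀ l, push g φ v l =
      ∑ l' ∈ v.support, push g φ (Finsupp.single l' (v l')) l := by
    intro l
    conv_lhs => rw [← Finsupp.sum_single v, Finsupp.sum, map_sum, Finsupp.finsetSum_apply]
  refine ⟨fun k => by rw [swapHom_push, hv.1], fun l => ?_, fun l hl => ?_⟩
  · rw [key]
    refine sum_mem fun l' _ => ?_
    by_cases h : 0 ∈ l'.map φ
    · rw [push_single_of_mem _ _ h]; exact zero_mem _
    · rw [push_single_of_notMem _ _ h, Finsupp.single_apply]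
      split_ifs
      · exact hI (hv.2.1 l')
      · exact zero_mem _
  · rw [key] at hl
    obtain ⟨l', hl', hne⟩ := Finset.exists_ne_zero_of_sum_ne_zero hl
    by_cases h : 0 ∈ l'.map φ
    · rw [push_single_of_mem _ _ h] at hne; exact absurd rfl hne
    · rw [push_single_of_notMem _ _ h, Finsupp.single_apply] at hne
      have heq : l'.map φ = l := by
        by_contra h'; exact hne (if_neg h')
      subst heq
      exact ⟨by simpa using (hv.2.2 l' (Finsupp.mem_support_iff.1 hl')).1, h⟩

theorem push_id_of_mem_forms (hv : v ∈ forms S I p) : push (RingHom.id C) id v = v := by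
  conv_lhs => rw [← Finsupp.sum_single v, Finsupp.sum, map_sum]
  conv_rhs => rw [← Finsupp.sum_single v, Finsupp.sum]
  refine Finset.sum_congr rfl fun l hl => ?_
  rw [push_single_of_notMem _ _ (by simpa using (hv.2.2 l (Finsupp.mem_support_iff.1 hl)).2)]
  simp

/-- The constant map to the base point induces zero in positive degrees. -/
theorem push_zero_of_mem_forms (g : C →+* C') (hv : v ∈ forms S I (p + 1)) :
    push g (fun _ : S => (0 : S')) v = 0 := by
  conv_lhs => rw [← Finsupp.sum_single v, Finsupp.sum, map_sum]
  refine Finset.sum_eq_zero fun l hl => push_single_of_mem _ _ ?_ _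
  have := (hv.2.2 l (Finsupp.mem_support_iff.1 hl)).1
  rcases l with _ | ⟨s, l⟩
  · simp at this
  · simp

theorem contract_mem_forms {I' : Ideal C} {f : S → C} (hf : ∀ s, ∀ c ∈ I, f s * c ∈ I')
    (hv : v ∈ forms S I (p + 1)) : contract f v ∈ forms S I' p := by
  obtain ⟨A, hA⟩ := exists_letters v
  have key := contract_apply f v A fun s l h => hA _ h s List.mem_cons_self
  refine ⟨fun k => by rw [swapHom_contract, hv.1], fun l => ?_, fun l hl => ?_⟩
  · rw [key]; exact sum_mem fun s _ => hf s _ (hv.2.1 _)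
  · rw [key] at hl
    obtain ⟨s, -, hs⟩ := Finset.exists_ne_zero_of_sum_ne_zero hl
    have := hv.2.2 _ (right_ne_zero_of_mul hs)
    simpa [not_or] using And.imp_right (fun h => (not_or.1 (fun h' => h (List.mem_cons.2 h'))).2) this

theorem eq_single_nil_of_mem_forms (hv : v ∈ forms S I 0) : Finsupp.single [] (v []) = v := by
  ext l
  rcases l with _ | ⟨s, l⟩
  · simp
  · have : v (s :: l) = 0 := by
      by_contra h
      simpa using (hv.2.2 _ h).1
    simp [this]

/-- Elements of degree zero are elements of the ideal. -/
def formsZeroEquiv (S : Type*) [Zero S] (I : Ideal C) : I ≃+ forms S I 0 where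
  toFun c := ⟨Finsupp.single [] (c : C), fun k => by
      rw [swapHom_single]; cases k <;> rfl, fun l => by
        classical
        rw [Finsupp.single_apply]
        split_ifs
        · exact c.2
        · exact zero_mem _, fun l hl => by
        classical
        obtain rfl : [] = l := by
          by_contra h
          exact hl (Finsupp.single_eq_of_ne' h)
        simp⟩
  invFun v := ⟨v.1 [], v.2.2.1 []⟩
  left_inv c := by simp
  right_inv v := Subtype.ext (eq_single_nil_of_mem_forms v.2)
  map_add' c d := Subtype.ext (Finsupp.single_add _ _ _)

/-- Exactness of the Koszul complex `⋯ → J^{j} ⊗ Γᵖ⁺¹ → J^{j + 1} ⊗ Γᵖ → ⋯`. -/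
theorem exists_contract_eq {σ : Type*} {J : Ideal C} (E : ExteriorCoordinates J σ)
    (h2 : (2 : C) = 0) (f : S → C) (hf0 : f 0 = 0) (hfJ : ∀ s, f s ∈ J)
    (hf : ∀ c ∈ J, ∃ s, f s = c) (j : ℕ) (hv : v ∈ forms S (J ^ (j + 1)) p)
    (hd : contract f v = 0) : ∃ w ∈ forms S (J ^ j) (p + 1), contract f w = v := by
  classical
  obtain ⟨A, hA⟩ := exists_letters v
  -- symmetric functions on words are functions on multisets
  set v' : Multiset S → C := fun m => v m.toList
  have hv' : ∀ l : List S, v' l = v l := fun l =>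
    eq_of_perm (apply_swapAt_of_mem_forms hv) (Multiset.coe_eq_coe.1 (Multiset.coe_toList _))
  obtain ⟨B, w', hw', hwv⟩ := exists_diff_eq E h2 f hfJ hf A p j v'
    ⟨fun m => hv.2.1 _, fun m hm => by simpa using (hv.2.2 _ hm).1,
      fun m hm s hs => hA _ hm s (by simpa using hs)⟩
    (v.finite_range.subset (by rintro _ ⟨m, rfl⟩; exact ⟨_, rfl⟩)) (by
      ext m
      obtain ⟨l, rfl⟩ := Quot.exists_rep m
      have := DFunLike.congr_fun hd l
      rw [contract_apply f v A fun s l h => hA _ h s List.mem_cons_self] at this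
      refine Eq.trans (Finset.sum_congr rfl fun s _ => ?_) this
      exact congrArg _ (hv' (s :: l)))
  -- discard the words of the primitive `w'` that involve the base point; since `f 0 = 0`, this does
  -- not change its contraction on the other words
  have hfin : {l : List S | w' l ≠ 0 ∧ 0 ∉ l}.Finite := by
    refine (Set.finite_range fun g : Fin (p + 1) → B => List.ofFn fun i => (g i : S)).subset ?_
    rintro l ⟨hl, -⟩
    have hlen : l.length = p + 1 := by simpa using hw'.card _ hl
    refine ⟨fun i => ⟨l.get (i.cast hlen.symm), hw'.letters _ hl _ (by simp)⟩, ?_⟩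
    refine List.ext_getElem (by simp only [List.length_ofFn, hlen]) fun i h h' => ?_
    simp only [List.getElem_ofFn]
    rfl
  set w : List S →₀ C := Finsupp.onFinset hfin.toFinset (fun l => if 0 ∈ l then 0 else w' l) (by
    intro l hl
    by_cases h0 : 0 ∈ l
    · simp [h0] at hl
    · simpa [h0] using hl) with hw
  have hwl : ∀ l, w l = if 0 ∈ l then 0 else w' l := fun l => rfl
  have hne : ∀ l, w l ≠ 0 → w' l ≠ 0 ∧ 0 ∉ l := fun l hl => by
    rw [hwl] at hl
    by_cases h0 : 0 ∈ l
    · simp [h0] at hl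
    · exact ⟨by simpa [h0] using hl, h0⟩
  refine ⟨w, ⟨fun k => ?_, fun l => ?_, fun l hl => ?_⟩, ?_⟩
  · ext l
    rw [swapHom_apply, hwl, hwl, Multiset.coe_eq_coe.2 (swapAt_perm k l)]
    simp only [(swapAt_perm k l).mem_iff]
  · rw [hwl]
    split_ifs
    · exact zero_mem _
    · exact hw'.mem _
  · exact ⟨by simpa using hw'.card _ (hne l hl).1, (hne l hl).2⟩
  · ext l
    rw [contract_apply f w B fun s l h => hw'.letters _ (hne _ h).1 s (by simp)]
    by_cases h0 : 0 ∈ l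
    · have : v l = 0 := by
        by_contra h
        exact (hv.2.2 l h).2 h0
      rw [this]
      refine Finset.sum_eq_zero fun s _ => ?_
      rw [hwl, if_pos (List.mem_cons_of_mem s h0), mul_zero]
    · rw [← hv', ← hwv]
      refine Finset.sum_congr rfl fun s _ => ?_
      by_cases hs : s = 0
      · rw [hs, hf0, zero_mul, zero_mul]
      · rw [hwl, if_neg, Multiset.cons_coe]
        rw [List.mem_cons, not_or]
        exact ⟨fun h => hs h.symm, h0⟩

end Words

end Koszul

/-! ### Resolutions by acyclic complexes and contractions -/

open Opposite SimplexCategory Simplicial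

/-- Vanishing of homology in terms of elements. For `i = 0` the condition on `x` is void, because
`K.d 0 (0 - 1) = K.d 0 0 = 0`. -/
theorem isZero_homology_iff (K : ChainComplex AddCommGrpCat.{u} ℕ) (i : ℕ) :
    IsZero (K.homology i) ↔ ∀ x : K.X i, K.d i (i - 1) x = 0 → ∃ y, K.d (i + 1) i y = x := by
  rw [← HomologicalComplex.exactAt_iff_isZero_homology,
    K.exactAt_iff' (i + 1) i (i - 1) (by simp) (by cases i <;> simp),
    ShortComplex.ab_exact_iff]
  rfl

/-- Cycles for the differential of a sequence of complexes `⋯ → K 1 → K 0`, where every element of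
`K 0` is regarded as a cycle. -/
def IsClosed {K : ℕ → ChainComplex AddCommGrpCat.{u} ℕ} (D : ∀ p, K (p + 1) ⟶ K p)
    (p i : ℕ) (x : (K p).X i) : Prop :=
  match p, x with
  | 0, _ => True
  | p + 1, x => (D p).f i x = 0

/-- If the sequence of complexes `K n → ⋯ → K 1 → K 0 → 0` is exact at `K p` for `p < n` and all `K p`
with `p ≥ 1` are acyclic, then every cycle `x` of degree `i < n` in `K 0` is a boundary (the case
`p = 0`). For the induction, the statement is about closed cycles in `K p`. -/
theorem exists_d_comp_eq {K : ℕ → ChainComplex AddCommGrpCat.{u} ℕ} (D : ∀ p, K (p + 1) ⟶ K p)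
    (hD : ∀ p i x, (D p).f i ((D (p + 1)).f i x) = 0) (n : ℕ)
    (hexact : ∀ p < n, ∀ i x, IsClosed D p i x → ∃ y, (D p).f i y = x)
    (acyclic : ∀ p i, IsZero ((K (p + 1)).homology i)) (i p : ℕ) (hip : p + i < n)
    (x : (K p).X i) (hx : (K p).d i (i - 1) x = 0) (hDx : IsClosed D p i x) :
    ∃ y, (D p).f i ((K (p + 1)).d (i + 1) i y) = x := by
  have comm : ∀ p i j (x : (K (p + 1)).X i),
      (D p).f j ((K (p + 1)).d i j x) = (K p).d i j ((D p).f i x) := fun p i j x =>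
    (ConcreteCategory.congr_hom ((D p).comm i j) x).symm
  induction i generalizing p with
  | zero =>
    obtain ⟨z, rfl⟩ := hexact p (by omega) 0 x hDx
    obtain ⟨y, hy⟩ := (isZero_homology_iff _ _).1 (acyclic p 0) z (by
      rw [HomologicalComplex.shape _ _ _ (by simp)]; rfl)
    exact ⟨y, by rw [hy]⟩
  | succ i ih =>
    obtain ⟨z, rfl⟩ := hexact p (by omega) (i + 1) x hDx
    obtain ⟨w, hw⟩ := ih (p + 1) (by omega) ((K (p + 1)).d (i + 1) i z)
      (ConcreteCategory.congr_hom ((K (p + 1)).d_comp_d (i + 1) i (i - 1)) z)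
      ((comm p _ _ z).trans hx)
    obtain ⟨y, hy⟩ := (isZero_homology_iff _ _).1 (acyclic p (i + 1))
      (z - (D (p + 1)).f (i + 1) w) (by
        rw [map_sub, ← comm]
        exact sub_eq_zero.2 hw.symm)
    exact ⟨y, by rw [hy, map_sub, hD, sub_zero]⟩

/-- The map `[m] → [1]` which sends `j` to `0` if and only if `j < c`. -/
def cut (m c : ℕ) : ⦋m⦌ ⟶ ⦋1⦌ :=
  mkHom ⟨fun j => if j.val < c then 0 else 1, fun i j hij => by
    have : i.val ≤ j.val := hij
    dsimp only
    split_ifs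
    · rfl
    · exact Fin.zero_le _
    · omega
    · rfl⟩

theorem cut_apply (m c : ℕ) (j : Fin (m + 1)) :
    (cut m c).toOrderHom j = if j.val < c then 0 else 1 := rfl

theorem δ_comp_cut (m c : ℕ) (k : Fin (m + 2)) :
    δ k ≫ cut (m + 1) c = cut m (if k.val < c then c - 1 else c) := by
  ext j : 3
  change (cut (m + 1) c).toOrderHom (k.succAbove j) = _
  rw [cut_apply, cut_apply]
  congr 1
  by_cases h : j.castSucc < k
  · rw [Fin.succAbove_of_castSucc_lt _ _ h]
    have : j.val < k.val := h
    simp only [Fin.val_castSucc, eq_iff_iff]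
    split_ifs <;> omega
  · rw [Fin.succAbove_of_le_castSucc _ _ (not_lt.1 h)]
    have : k.val ≤ j.val := not_lt.1 h
    simp only [Fin.val_succ, eq_iff_iff]
    split_ifs <;> omega

theorem σ_comp_cut (m c : ℕ) (k : Fin (m + 1)) :
    σ k ≫ cut m c = cut (m + 1) (if k.val < c then c + 1 else c) := by
  ext j : 3
  change (cut m c).toOrderHom (k.predAbove j) = _
  rw [cut_apply, cut_apply]
  congr 1
  by_cases h : k.castSucc < j
  · rw [Fin.predAbove_of_castSucc_lt _ _ h]
    have : k.val < j.val := h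
    simp only [Fin.val_pred, eq_iff_iff]
    split_ifs <;> omega
  · rw [Fin.predAbove_of_le_castSucc _ _ (not_lt.1 h)]
    have : j.val ≤ k.val := not_lt.1 h
    simp only [Fin.coe_castPred, eq_iff_iff]
    split_ifs <;> omega

/-- A natural family of endomorphisms `H α` of `Xₘ`, indexed by the `m`-simplices `α` of `Δ¹`, is a
homotopy `Δ¹ × X → X`; here it contracts `X` to zero. In the description of homotopies by maps
`h i : Xₘ → Xₘ₊₁` it becomes `h i = H (cut (i + 1)) ∘ σ i`. The conditions that involve `σ` and `δ`
only are read off from the constant homotopy. -/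
def nullHomotopy (X : SimplicialObject AddCommGrpCat.{u})
    (H : ∀ m : ℕ, (⦋m⦌ ⟶ ⦋1⦌) → (X _⦋m⦌ ⟶ X _⦋m⦌))
    (nat : ∀ (a b : ℕ) (θ : ⦋a⦌ ⟶ ⦋b⦌) (α : ⦋b⦌ ⟶ ⦋1⦌),
      H b α ≫ X.map θ.op = X.map θ.op ≫ H a (θ ≫ α))
    (H_one : ∀ m, H m (cut m 0) = 𝟙 _) (H_zero : ∀ m, H m (cut m (m + 1)) = 0) :
    SimplicialObject.Homotopy (0 : X ⟶ X) (𝟙 X) where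
  h {m} i := X.σ i ≫ H (m + 1) (cut (m + 1) (i.val + 1))
  h_zero_comp_δ_zero m := by
    have h1 := (SimplicialObject.Homotopy.refl (𝟙 X)).h_zero_comp_δ_zero m
    simp only [SimplicialObject.Homotopy.refl_h, NatTrans.id_app, Category.comp_id] at h1
    rw [Category.assoc, SimplicialObject.δ, nat, δ_comp_cut, ← Category.assoc]
    erw [h1]
    simp [H_one]
  h_last_comp_δ_last m := by
    have h1 := (SimplicialObject.Homotopy.refl (𝟙 X)).h_last_comp_δ_last m
    simp only [SimplicialObject.Homotopy.refl_h, NatTrans.id_app, Category.comp_id] at h1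
    rw [Category.assoc, SimplicialObject.δ, nat, δ_comp_cut, ← Category.assoc]
    erw [h1]
    simp [H_zero]
  h_succ_comp_δ_castSucc_of_lt {m} i j hij := by
    have h1 := (SimplicialObject.Homotopy.refl (𝟙 X)).h_succ_comp_δ_castSucc_of_lt i j hij
    simp only [SimplicialObject.Homotopy.refl_h, NatTrans.id_app, Category.comp_id] at h1
    have hij' : i.val ≤ j.val := hij
    rw [Category.assoc, SimplicialObject.δ, nat, δ_comp_cut, ← Category.assoc]
    erw [h1]
    rw [Category.assoc, if_pos (by simp; omega)]
    simp
  h_succ_comp_δ_castSucc_succ {m} j := by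
    have h1 := (SimplicialObject.Homotopy.refl (𝟙 X)).h_succ_comp_δ_castSucc_succ j
    simp only [SimplicialObject.Homotopy.refl_h, NatTrans.id_app, Category.comp_id] at h1
    rw [Category.assoc, Category.assoc, SimplicialObject.δ, nat, nat, δ_comp_cut, δ_comp_cut,
      ← Category.assoc, ← Category.assoc]
    erw [h1]
    rw [if_pos (by simp), if_neg (by simp)]
    simp
    rfl
  h_castSucc_comp_δ_succ_of_lt {m} i j hij := by
    have h1 := (SimplicialObject.Homotopy.refl (𝟙 X)).h_castSucc_comp_δ_succ_of_lt i j hij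
    simp only [SimplicialObject.Homotopy.refl_h, NatTrans.id_app, Category.comp_id] at h1
    have hij' : j.val < i.val := hij
    rw [Category.assoc, SimplicialObject.δ, nat, δ_comp_cut, ← Category.assoc]
    erw [h1]
    rw [Category.assoc, if_neg (by simp; omega)]
    simp
  h_comp_σ_castSucc_of_le {m} i j hij := by
    have h1 := (SimplicialObject.Homotopy.refl (𝟙 X)).h_comp_σ_castSucc_of_le i j hij
    simp only [SimplicialObject.Homotopy.refl_h, NatTrans.id_app, Category.comp_id] at h1
    have hij' : i.val ≤ j.val := hij
    rw [Category.assoc]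
    conv_lhs => rw [SimplicialObject.σ, SimplicialObject.σ, nat, σ_comp_cut, ← Category.assoc]
    erw [h1]
    rw [Category.assoc, if_pos (by simp; omega)]
    simp
  h_comp_σ_succ_of_lt {m} i j hij := by
    have h1 := (SimplicialObject.Homotopy.refl (𝟙 X)).h_comp_σ_succ_of_lt i j hij
    simp only [SimplicialObject.Homotopy.refl_h, NatTrans.id_app, Category.comp_id] at h1
    have hij' : j.val ≤ i.val := hij
    rw [Category.assoc]
    conv_lhs => rw [SimplicialObject.σ, SimplicialObject.σ, nat, σ_comp_cut, ← Category.assoc]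
    erw [h1]
    rw [Category.assoc, if_neg (by simp; omega)]
    simp

theorem isZero_homology_of_homotopy (X : SimplicialObject AddCommGrpCat.{u})
    (h : SimplicialObject.Homotopy (0 : X ⟶ X) (𝟙 X)) (i : ℕ) :
    IsZero ((chains.obj X).homology i) := by
  rw [IsZero.iff_id_eq_zero, ← HomologicalComplex.homologyMap_id]
  have h1 := h.toChainHomotopy.homologyMap_eq i
  have h2 : chains.map (0 : X ⟶ X) = 0 := by ext; rfl
  have h3 : chains.map (𝟙 X) = 𝟙 _ := chains.map_id X
  erw [h2, h3] at h1
  rw [← h1, HomologicalComplex.homologyMap_zero]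

/-! ### Powers of a simplicial ideal -/

/-- An ideal of a simplicial commutative ring. -/
structure SimplicialIdeal (C : SimplicialObject CommRingCat.{u}) where
  /-- the ideal in each simplicial degree -/
  ideal : ∀ X : SimplexCategoryᵒᵖ, Ideal (C.obj X)
  le_comap : ∀ {X Y : SimplexCategoryᵒᵖ} (f : X ⟶ Y), ideal X ≤ (ideal Y).comap (C.map f).hom

namespace SimplicialIdeal

variable {C : SimplicialObject CommRingCat.{u}} (J : SimplicialIdeal C)

theorem pow_le_comap (n : ℕ) {X Y : SimplexCategoryᵒᵖ} (f : X ⟶ Y) :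
    J.ideal X ^ n ≤ (J.ideal Y ^ n).comap (C.map f).hom :=
  (Ideal.pow_right_mono (J.le_comap f) n).trans (Ideal.le_comap_pow _ n)

/-- The simplicial abelian group `J ^ n`. -/
def pow (n : ℕ) : SimplicialObject AddCommGrpCat.{u} where
  obj X := AddCommGrpCat.of ↥(J.ideal X ^ n)
  map {X Y} f := AddCommGrpCat.ofHom
    { toFun := fun x => (⟨(C.map f).hom x, J.pow_le_comap n f x.2⟩ : ↥(J.ideal Y ^ n))
      map_zero' := Subtype.ext (map_zero _)
      map_add' := fun _ _ => Subtype.ext (map_add _ _ _) }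
  map_id X := by
    refine AddCommGrpCat.hom_ext (AddMonoidHom.ext fun x => Subtype.ext ?_)
    exact (ConcreteCategory.congr_hom (C.map_id X) x.1)
  map_comp f g := by
    refine AddCommGrpCat.hom_ext (AddMonoidHom.ext fun x => Subtype.ext ?_)
    exact (ConcreteCategory.congr_hom (C.map_comp f g) x.1)

/-! ### Paths starting at zero -/

/-- The cone `[0] ⋆ X`, with `0` as additional first vertex. -/
abbrev cone (X : SimplexCategory) : SimplexCategory := ⦋X.len + 1⦌

/-- The map of cones induced by `θ`. -/
def coneMap {X Y : SimplexCategory} (θ : X ⟶ Y) : cone X ⟶ cone Y :=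
  mkHom ⟨Fin.cases 0 fun i => (θ.toOrderHom i).succ, fun i j hij => by
    induction i using Fin.cases with
    | zero => exact Fin.zero_le _
    | succ i =>
      induction j using Fin.cases with
      | zero => exact absurd hij (by simp)
      | succ j =>
        simp only [Fin.cases_succ, Fin.succ_le_succ_iff] at hij ⊢
        exact θ.toOrderHom.monotone hij⟩

/-- The inclusion of the face opposite to the vertex of the cone. -/
def coneBase (X : SimplexCategory) : X ⟶ cone X := mkHom ⟨Fin.succ, Fin.strictMono_succ.monotone⟩

/-- The inclusion of the vertex of the cone. -/
def coneVertex (X : SimplexCategory) : ⦋0⦌ ⟶ cone X :=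
  mkHom ⟨fun _ => 0, fun _ _ _ => le_rfl⟩

/-- The map to the terminal object. -/
def toPoint (X : SimplexCategory) : X ⟶ ⦋0⦌ := mkHom ⟨fun _ => 0, fun _ _ _ => le_rfl⟩

/-- The endomorphism of the cone which collapses the vertices of `X` in `α⁻¹(0)` to the vertex of the
cone. For varying `α` this is the contraction of the cone to its vertex. -/
def collapse {X : SimplexCategory} (α : X ⟶ ⦋1⦌) : cone X ⟶ cone X :=
  mkHom ⟨Fin.cases 0 fun i => if α.toOrderHom i = 0 then 0 else i.succ, fun i j hij => by
    induction i using Fin.cases with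
    | zero => exact Fin.zero_le _
    | succ i =>
      induction j using Fin.cases with
      | zero => exact absurd hij (by simp)
      | succ j =>
        simp only [Fin.cases_succ, Fin.succ_le_succ_iff] at hij ⊢
        have := α.toOrderHom.monotone hij
        split_ifs with h1 h2
        · exact le_rfl
        · exact Fin.zero_le _
        · rename_i h2
          rw [h2] at this
          exact absurd (Fin.le_zero_iff.1 this) h1
        · exact Fin.succ_le_succ_iff.2 hij⟩

/-- The first vertex. -/
def firstVertex (X : SimplexCategory) : ⦋0⦌ ⟶ X := mkHom ⟨fun _ => 0, fun _ _ _ => le_rfl⟩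

/-- The degeneracy which identifies the vertex of the cone with the first vertex. -/
def coneFold (X : SimplexCategory) : cone X ⟶ X :=
  mkHom ⟨Fin.cases 0 fun i => i, fun i j hij => by
    induction i using Fin.cases with
    | zero => exact Fin.zero_le _
    | succ i =>
      induction j using Fin.cases with
      | zero => exact absurd hij (by simp)
      | succ j => exact Fin.succ_le_succ_iff.1 hij⟩

/-- The map to `[1]` which sends the vertex of the cone to `0` and the base to `1`. -/
def coneToEdge (X : SimplexCategory) : cone X ⟶ ⦋1⦌ := cut _ 1

theorem coneMap_id (X : SimplexCategory) : coneMap (𝟙 X) = 𝟙 (cone X) := by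
  ext i : 3
  induction i using Fin.cases <;> rfl

theorem coneMap_comp {X Y Z : SimplexCategory} (θ : X ⟶ Y) (η : Y ⟶ Z) :
    coneMap (θ ≫ η) = coneMap θ ≫ coneMap η := by
  ext i : 3
  induction i using Fin.cases <;> rfl

theorem coneVertex_naturality {X Y : SimplexCategory} (θ : X ⟶ Y) :
    coneVertex X ≫ coneMap θ = coneVertex Y := rfl

theorem coneVertex_collapse {X : SimplexCategory} (α : X ⟶ ⦋1⦌) :
    coneVertex X ≫ collapse α = coneVertex X := rfl

theorem coneMap_collapse {X Y : SimplexCategory} (θ : X ⟶ Y) (α : Y ⟶ ⦋1⦌) :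
    coneMap θ ≫ collapse α = collapse (θ ≫ α) ≫ coneMap θ := by
  ext i : 3
  induction i using Fin.cases with
  | zero => rfl
  | succ i =>
    change (if α.toOrderHom (θ.toOrderHom i) = 0 then 0 else (θ.toOrderHom i).succ) =
      (coneMap θ).toOrderHom (if α.toOrderHom (θ.toOrderHom i) = 0 then 0 else i.succ)
    split_ifs <;> rfl

theorem collapse_eq_id {m : ℕ} : collapse (cut m 0) = 𝟙 (cone ⦋m⦌) := by
  ext i : 3
  induction i using Fin.cases with
  | zero => rfl
  | succ i => rfl

theorem collapse_eq_const {m : ℕ} :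
    collapse (cut m (m + 1)) = toPoint (cone ⦋m⦌) ≫ coneVertex ⦋m⦌ := by
  ext i : 3
  induction i using Fin.cases with
  | zero => rfl
  | succ i =>
    change (if (cut m (m + 1)).toOrderHom i = 0 then 0 else i.succ) = 0
    rw [cut_apply, if_pos i.2, if_pos rfl]

/-- The paths in `J` which start at zero: elements of `J` on the cone over `X` which vanish at the
vertex of the cone. -/
def pathIdeal (X : SimplexCategoryᵒᵖ) : Ideal (C.obj (op (cone X.unop))) :=
  J.ideal _ ⊓ RingHom.ker (C.map (coneVertex X.unop).op).hom

theorem map_map_apply {X Y Z : SimplexCategoryᵒᵖ} (f : X ⟶ Y) (g : Y ⟶ Z) (x : C.obj X) :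
    (C.map g).hom ((C.map f).hom x) = (C.map (f ≫ g)).hom x :=
  (ConcreteCategory.congr_hom (C.map_comp f g) x).symm

/-- The action on paths of a map of cones which preserves the vertex. -/
def pathMap {X Y : SimplexCategoryᵒᵖ} (θ : cone Y.unop ⟶ cone X.unop)
    (hθ : coneVertex Y.unop ≫ θ = coneVertex X.unop) (x : J.pathIdeal X) : J.pathIdeal Y :=
  ⟨(C.map θ.op).hom x.1, J.le_comap _ x.2.1, by
    refine RingHom.mem_ker.2 ?_
    rw [map_map_apply, ← op_comp, hθ]
    exact x.2.2⟩

/-- The end of a path: its restriction to the base of the cone. -/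
def pathEnd (X : SimplexCategoryᵒᵖ) (x : J.pathIdeal X) : C.obj X :=
  (C.map (coneBase X.unop).op).hom x.1

theorem pathEnd_zero (X : SimplexCategoryᵒᵖ) : J.pathEnd X 0 = 0 := map_zero _

theorem pathEnd_mem (X : SimplexCategoryᵒᵖ) (x : J.pathIdeal X) : J.pathEnd X x ∈ J.ideal X :=
  J.le_comap (coneBase X.unop).op x.2.1

theorem pathMap_zero {X Y : SimplexCategoryᵒᵖ} (θ : cone Y.unop ⟶ cone X.unop)
    (hθ : coneVertex Y.unop ≫ θ = coneVertex X.unop) : J.pathMap θ hθ 0 = 0 :=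
  Subtype.ext (map_zero _)

theorem pathMap_comp {X Y Z : SimplexCategoryᵒᵖ} (θ : cone Y.unop ⟶ cone X.unop)
    (hθ : coneVertex Y.unop ≫ θ = coneVertex X.unop) (η : cone Z.unop ⟶ cone Y.unop)
    (hη : coneVertex Z.unop ≫ η = coneVertex Y.unop) :
    J.pathMap η hη ∘ J.pathMap θ hθ = J.pathMap (η ≫ θ) (by rw [← Category.assoc, hη, hθ]) :=
  funext fun _ => Subtype.ext (map_map_apply _ _ _)

theorem pathMap_id {X : SimplexCategoryᵒᵖ} : J.pathMap (𝟙 (cone X.unop)) (Category.comp_id _) =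
    (id : J.pathIdeal X → J.pathIdeal X) :=
  funext fun x => Subtype.ext (ConcreteCategory.congr_hom (C.map_id _) x.1)

theorem pathMap_congr {X Y : SimplexCategoryᵒᵖ} {θ θ' : cone Y.unop ⟶ cone X.unop} (h : θ = θ')
    (hθ : coneVertex Y.unop ≫ θ = coneVertex X.unop) :
    J.pathMap θ hθ = J.pathMap θ' (h ▸ hθ) := by subst h; rfl

theorem pathEnd_pathMap {X Y : SimplexCategoryᵒᵖ} (f : X ⟶ Y) (x : J.pathIdeal X) :
    J.pathEnd Y (J.pathMap (coneMap f.unop) (coneVertex_naturality _) x) =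
      (C.map f).hom (J.pathEnd X x) := by
  refine (map_map_apply _ _ _).trans (Eq.trans ?_ (map_map_apply _ _ _).symm)
  rfl

/-- If `π₀ J = 0`, every element of `J` is the end of a path which starts at zero. -/
theorem pathEnd_surjective (h0 : IsZero ((chains.obj (J.pow 1)).homology 0))
    (X : SimplexCategoryᵒᵖ) (x : C.obj X) (hx : x ∈ J.ideal X) : ∃ y, J.pathEnd X y = x := by
  -- `z` is an edge in `J` with `d₀ z - d₁ z = a`, where `a` is the first vertex of `x`
  obtain ⟨z, hz⟩ := (isZero_homology_iff _ _).1 h0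
    (⟨(C.map (firstVertex X.unop).op).hom x, by
      rw [pow_one]; exact J.le_comap (firstVertex X.unop).op hx⟩ : ↥(J.ideal (op ⦋0⦌) ^ 1))
    (by rw [HomologicalComplex.shape _ _ _ (by simp)]; rfl)
  obtain ⟨z, hzJ⟩ : ↥(J.ideal (op ⦋1⦌) ^ 1) := z
  rw [pow_one] at hzJ
  have hz' : (C.map (SimplexCategory.δ 0).op).hom z - (C.map (SimplexCategory.δ 1).op).hom z =
      (C.map (firstVertex X.unop).op).hom x := by
    refine Eq.trans ?_ (congrArg Subtype.val hz)
    have : (chains.obj (J.pow 1)).d 1 0 = (J.pow 1).δ 0 - (J.pow 1).δ 1 := by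
      simp [Fin.sum_univ_two, sub_eq_add_neg]
    rw [this]
    rfl
  -- `e` is an edge from `a` to `0`; the degenerate path `coneFold^* x` starts at `a`, and is corrected by
  -- the pullback of `e`
  let e : C.obj (op ⦋1⦌) := (C.map (toPoint ⦋1⦌).op).hom ((C.map (SimplexCategory.δ 0).op).hom z) - z
  have heJ : e ∈ J.ideal (op ⦋1⦌) :=
    sub_mem (J.le_comap (toPoint ⦋1⦌).op (J.le_comap (SimplexCategory.δ 0).op hzJ)) hzJ
  have he : ∀ i : ⦋0⦌ ⟶ ⦋1⦌, (C.map i.op).hom e =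
      (C.map (SimplexCategory.δ 0).op).hom z - (C.map i.op).hom z := by
    intro i
    have hi : i ≫ toPoint ⦋1⦌ = 𝟙 ⦋0⦌ := by
      ext j : 3
      exact Subsingleton.elim (α := Fin 1) _ _
    rw [map_sub, map_map_apply, ← op_comp, hi]
    exact congrArg (· - _) (ConcreteCategory.congr_hom (C.map_id _) _)
  refine ⟨⟨(C.map (coneFold X.unop).op).hom x - (C.map (coneToEdge X.unop).op).hom e,
    sub_mem (J.le_comap (coneFold X.unop).op hx) (J.le_comap (coneToEdge X.unop).op heJ), ?_⟩, ?_⟩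
  · refine RingHom.mem_ker.2 ?_
    rw [map_sub, map_map_apply, map_map_apply, ← op_comp, ← op_comp,
      show coneVertex X.unop ≫ coneToEdge X.unop = SimplexCategory.δ 1 from by
        ext j : 3
        obtain rfl := Subsingleton.elim (α := Fin 1) j 0
        rfl, he, hz']
    exact sub_self _
  · change (C.map (coneBase X.unop).op).hom _ = x
    rw [map_sub, map_map_apply, map_map_apply, ← op_comp, ← op_comp,
      show coneBase X.unop ≫ coneToEdge X.unop = toPoint X.unop ≫ SimplexCategory.δ 0 from rfl,
      show coneBase X.unop ≫ coneFold X.unop = 𝟙 X.unop from rfl, op_comp, ← map_map_apply, he,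
      sub_self, map_zero, sub_zero]
    exact ConcreteCategory.congr_hom (C.map_id X) x

/-! ### The Koszul resolution -/

open Koszul

/-- The simplicial abelian group `J ^ j ⊗ Γᵖ(F₂[S] / F₂[0])`, where `S` is the simplicial set of paths in
`J` which start at zero. -/
def koszul (j p : ℕ) : SimplicialObject AddCommGrpCat.{u} where
  obj X := AddCommGrpCat.of ↥(forms (J.pathIdeal X) (J.ideal X ^ j) p)
  map {X Y} f := AddCommGrpCat.ofHom
    (((push (C.map f).hom (J.pathMap (coneMap f.unop) (coneVertex_naturality _))).comp
      (forms (J.pathIdeal X) (J.ideal X ^ j) p).subtype).codRestrict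
        (forms (J.pathIdeal Y) (J.ideal Y ^ j) p)
        fun v => push_mem_forms _ _ (J.pow_le_comap j f) v.2)
  map_id X := by
    refine AddCommGrpCat.hom_ext (AddMonoidHom.ext fun v => Subtype.ext ?_)
    change push (C.map (𝟙 X)).hom (J.pathMap (coneMap (𝟙 X.unop)) _) v.1 = v.1
    rw [J.pathMap_congr (coneMap_id _), J.pathMap_id, C.map_id]
    exact push_id_of_mem_forms v.2
  map_comp {X Y Z} f g := by
    refine AddCommGrpCat.hom_ext (AddMonoidHom.ext fun v => Subtype.ext ?_)
    change push (C.map (f ≫ g)).hom (J.pathMap (coneMap (g.unop ≫ f.unop)) _) v.1 =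
      push (C.map g).hom _ (push (C.map f).hom _ v.1)
    rw [J.pathMap_congr (coneMap_comp _ _), C.map_comp,
      ← push_comp _ _ _ _ (J.pathMap_zero _ _), pathMap_comp]
    rfl

/-- The Koszul differential, which contracts with the ends of paths. It maps `J ^ j ⊗ Γᵖ⁺¹` to
`J ^ (j + 1) ⊗ Γᵖ`. The exponent `j'` of the target is allowed to be smaller, so that
`j = n - (p + 1)`, `j' = n - p` is covered for all `p` with truncated subtraction. -/
def koszulDiff (j j' p : ℕ) (hj : j' ≤ j + 1) : J.koszul j (p + 1) ⟶ J.koszul j' p where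
  app X := AddCommGrpCat.ofHom
    (((contract (J.pathEnd X)).comp
      (forms (J.pathIdeal X) (J.ideal X ^ j) (p + 1)).subtype).codRestrict
        (forms (J.pathIdeal X) (J.ideal X ^ j') p)
        fun v => contract_mem_forms (fun s c hc => Ideal.pow_le_pow_right hj (by
          rw [pow_succ']; exact Ideal.mul_mem_mul (J.pathEnd_mem X s) hc)) v.2)
  naturality X Y f := by
    ext v
    exact Subtype.ext (contract_push _ _ _ _ (J.pathEnd_zero Y) (fun s => J.pathEnd_pathMap f s) v.1)

/-- The action of an `m`-simplex of `Δ¹` by the contraction of paths to zero; the coefficients are not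
affected. -/
def koszulCollapse (j p m : ℕ) (α : ⦋m⦌ ⟶ ⦋1⦌) :
    (J.koszul j p) _⦋m⦌ ⟶ (J.koszul j p) _⦋m⦌ :=
  AddCommGrpCat.ofHom
    (((push (RingHom.id _) (J.pathMap (X := op ⦋m⦌) (Y := op ⦋m⦌) (collapse α)
      (coneVertex_collapse _))).comp
      (forms (J.pathIdeal (op ⦋m⦌)) (J.ideal (op ⦋m⦌) ^ j) p).subtype).codRestrict
        (forms (J.pathIdeal (op ⦋m⦌)) (J.ideal (op ⦋m⦌) ^ j) p)
        fun v => push_mem_forms _ _ (by rw [Ideal.comap_id]) v.2)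

theorem isZero_homology_koszul (j p i : ℕ) :
    IsZero ((chains.obj (J.koszul j (p + 1))).homology i) := by
  refine isZero_homology_of_homotopy _
    (nullHomotopy _ (J.koszulCollapse j (p + 1)) ?_ ?_ ?_) i
  · intro a b θ α
    ext v
    refine Subtype.ext ?_
    change push (C.map θ.op).hom (J.pathMap (coneMap θ) _)
        (push (RingHom.id _) (J.pathMap (collapse α) _) v.1) =
      push (RingHom.id _) (J.pathMap (collapse (θ ≫ α)) _)
        (push (C.map θ.op).hom (J.pathMap (coneMap θ) _) v.1)
    rw [← push_comp _ _ _ _ (J.pathMap_zero _ _), ← push_comp _ _ _ _ (J.pathMap_zero _ _),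
      pathMap_comp, pathMap_comp, J.pathMap_congr (coneMap_collapse θ α)]
    rfl
  · intro m
    ext v
    refine Subtype.ext ?_
    change push (RingHom.id _) (J.pathMap (collapse (cut m 0)) _) v.1 = v.1
    rw [J.pathMap_congr collapse_eq_id, J.pathMap_id]
    exact push_id_of_mem_forms v.2
  · intro m
    ext v
    refine Subtype.ext ?_
    change push (RingHom.id _) (J.pathMap (collapse (cut m (m + 1))) _) v.1 = 0
    have : J.pathMap (X := op ⦋m⦌) (Y := op ⦋m⦌) (collapse (cut m (m + 1)))
        (coneVertex_collapse _) = fun _ => 0 := by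
      rw [J.pathMap_congr collapse_eq_const]
      funext x
      refine Subtype.ext ?_
      change (C.map (toPoint _ ≫ coneVertex _).op).hom x.1 = 0
      rw [op_comp, ← map_map_apply, show (C.map (coneVertex _).op).hom x.1 = 0 from x.2.2, map_zero]
    rw [this]
    exact push_zero_of_mem_forms _ v.2

/-- The part of degree zero in the divided powers is `J ^ j`. -/
def powIsoKoszul (j : ℕ) : J.pow j ≅ J.koszul j 0 :=
  NatIso.ofComponents
    (fun X => AddEquiv.toAddCommGrpIso (X := (J.pow j).obj X) (Y := (J.koszul j 0).obj X)
      (formsZeroEquiv (J.pathIdeal X) (J.ideal X ^ j)))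
    (by
      intro X Y f
      refine AddCommGrpCat.hom_ext (AddMonoidHom.ext fun c => Subtype.ext ?_)
      exact (push_single_of_notMem (C.map f).hom
        (J.pathMap (coneMap f.unop) (coneVertex_naturality _)) (l := []) (by simp) c.1).symm)

/-- If `J` is levelwise exterior in characteristic two and `π₀ J = 0`, then `J ^ n` is
`(n - 1)`-connected. -/
theorem isConnectedUpTo_pow (h2 : ∀ X, (2 : C.obj X) = 0)
    (E : ∀ X, ∃ σ : Type u, Nonempty (ExteriorCoordinates (J.ideal X) σ))
    (h0 : IsConnectedUpTo (chains.obj (J.pow 1)) 0) (n : ℕ) :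
    IsConnectedUpTo (chains.obj (J.pow n)) ((n : ℤ) - 1) := by
  have hmul : ∀ X, ∀ c ∈ J.ideal X, c * c = 0 := by
    intro X c hc
    obtain ⟨σ, ⟨e⟩⟩ := E X
    exact mul_self_eq_zero_of_mem e (h2 X) hc
  intro i hi
  let K : ℕ → ChainComplex AddCommGrpCat.{u} ℕ := fun p => chains.obj (J.koszul (n - p) p)
  let D : ∀ p, K (p + 1) ⟶ K p := fun p =>
    chains.map (J.koszulDiff (n - (p + 1)) (n - p) p (by omega))
  have hK : IsZero ((K 0).homology i) := by
    rw [isZero_homology_iff]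
    intro x hx
    have hD : ∀ p i x, (D p).f i ((D (p + 1)).f i x) = 0 := fun p i x =>
      Subtype.ext (contract_contract (h2 _) _ (fun s => hmul _ _ (J.pathEnd_mem _ s)) x.1
        fun l => apply_swapAt_of_mem_forms x.2 0 l)
    have hexact : ∀ p < n, ∀ i x, IsClosed D p i x → ∃ y, (D p).f i y = x := by
      intro p hp i x hx
      obtain ⟨σ, ⟨e⟩⟩ := E (op ⦋i⦌)
      have hj : n - p = (n - (p + 1)) + 1 := by omega
      obtain ⟨v, hv⟩ : ↥(forms (J.pathIdeal (op ⦋i⦌)) (J.ideal (op ⦋i⦌) ^ (n - p)) p) := x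
      have hd : contract (J.pathEnd (op ⦋i⦌)) v = 0 := by
        cases p with
        | zero =>
          rw [← eq_single_nil_of_mem_forms hv, contract_single_nil]
        | succ p => exact congrArg Subtype.val hx
      obtain ⟨w, hw, hwv⟩ := exists_contract_eq e (h2 _) (J.pathEnd (op ⦋i⦌)) (J.pathEnd_zero _)
        (J.pathEnd_mem _) (J.pathEnd_surjective (h0 0 le_rfl) _) (n - (p + 1)) (hj ▸ hv) hd
      exact ⟨⟨w, hw⟩, Subtype.ext hwv⟩
    obtain ⟨y, hy⟩ := exists_d_comp_eq D hD n hexact (fun p i => J.isZero_homology_koszul _ p i) i 0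
      (by omega) x hx trivial
    exact ⟨(D 0).f (i + 1) y, (ConcreteCategory.congr_hom ((D 0).comm (i + 1) i) y).trans hy⟩
  exact hK.of_iso ((HomologicalComplex.homologyFunctor _ _ i).mapIso
    (chains.mapIso (J.powIsoKoszul n)))

end SimplicialIdeal

end RealHochschild

namespace RealHochschild

/-! ### Exterior coordinates for polynomial algebras -/

section Coordinates

variable (k : Type u) [CommRing k] {B : Type u} [CommRing B] [Algebra k B]

/-- The partial derivative `∂/∂xᵢ` of a polynomial algebra. -/
def partialDerivation {σ : Type*} (e : MvPolynomial σ k ≃ₐ[k] B) (i : σ) : Derivation k B B :=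
  Derivation.mk' (e.toLinearMap ∘ₗ (MvPolynomial.pderiv i).toLinearMap ∘ₗ e.symm.toLinearMap)
    fun a b => by simp [Derivation.leibniz]

theorem partialDerivation_apply {σ : Type*} (e : MvPolynomial σ k ≃ₐ[k] B) (i : σ)
    (p : MvPolynomial σ k) : partialDerivation k e i (e p) = e (MvPolynomial.pderiv i p) := by
  change e (MvPolynomial.pderiv i (e.symm (e p))) = _
  rw [e.symm_apply_apply]

variable [Fact ((2 : k) = 0)]

/-- A `k`-derivation of `B` is linear over `B⁽¹⁾`, because it kills squares. -/
theorem derivation_smul (D : Derivation k B B) (x : FrobTwist k B) (b : B) :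
    D (x • b) = x • D b := by
  induction x using FrobTwist.induction_on with
  | zero => simp
  | add x y hx hy => rw [add_smul, add_smul, map_add, hx, hy]
  | tmul r c =>
    have h2 : (2 : B) = 0 := two_eq_zero k B
    have hsmul : ∀ b : B, FrobTwist.tmul k r c • b = r • (c ^ 2 * b) := fun b => by
      rw [Algebra.smul_def, ← smul_mul_assoc]
      exact congrArg (· * b) (relFrob_tmul k B r c)
    rw [hsmul, hsmul, D.map_smul, D.leibniz, D.leibniz_pow]
    simp [h2]

/-- A `k`-derivation of `B` as a `B⁽¹⁾`-linear map. -/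
def twistLinear (D : Derivation k B B) : B →ₗ[FrobTwist k B] B where
  toFun := D
  map_add' := map_add D
  map_smul' := derivation_smul k D

/-- The derivation `id ⊗ D` of `C = B ⊗_{B⁽¹⁾} B`. -/
def tensorDerivation (D : Derivation k B B) : Derivation ℤ (FrobTensor k B) (FrobTensor k B) :=
  Derivation.mk' ((LinearMap.lTensor B (twistLinear k D)).restrictScalars ℤ) fun x y => by
    change LinearMap.lTensor B (twistLinear k D) (x * y) =
      x * LinearMap.lTensor B (twistLinear k D) y + y * LinearMap.lTensor B (twistLinear k D) x
    induction x using TensorProduct.induction_on with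
    | zero => simp
    | add x x' hx hx' => rw [add_mul, map_add, hx, hx', map_add]; ring
    | tmul a b =>
      induction y using TensorProduct.induction_on with
      | zero => simp
      | add y y' hy hy' => rw [mul_add, map_add, hy, hy', map_add]; ring
      | tmul c d =>
        rw [Algebra.TensorProduct.tmul_mul_tmul, LinearMap.lTensor_tmul, LinearMap.lTensor_tmul,
          LinearMap.lTensor_tmul, Algebra.TensorProduct.tmul_mul_tmul,
          Algebra.TensorProduct.tmul_mul_tmul, mul_comm c a, ← TensorProduct.tmul_add]
        exact congrArg _ (D.leibniz b d)

theorem tensorDerivation_one_tmul_sub (D : Derivation k B B) (b : B) :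
    tensorDerivation k D (1 ⊗ₜ b - b ⊗ₜ 1) = 1 ⊗ₜ D b := by
  change LinearMap.lTensor B (twistLinear k D) (1 ⊗ₜ b - b ⊗ₜ 1) = 1 ⊗ₜ D b
  rw [map_sub, LinearMap.lTensor_tmul, LinearMap.lTensor_tmul]
  change 1 ⊗ₜ D b - b ⊗ₜ D 1 = _
  rw [D.map_one_eq_zero, TensorProduct.tmul_zero, sub_zero]

theorem two_eq_zero_frobTensor (B : Type u) [CommRing B] [Algebra k B] :
    (2 : FrobTensor k B) = 0 := by
  rw [← map_ofNat (Algebra.TensorProduct.includeLeftRingHom : B →+* FrobTensor k B) 2,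
    two_eq_zero k B, map_zero]

theorem one_tmul_smul (x : FrobTwist k B) :
    (1 : B) ⊗ₜ[FrobTwist k B] (x • (1 : B)) = (x • (1 : B)) ⊗ₜ 1 := by
  rw [TensorProduct.tmul_smul, TensorProduct.smul_tmul']

theorem one_tmul_sq (b : B) : (1 : B) ⊗ₜ[FrobTwist k B] (b ^ 2) = (b ^ 2) ⊗ₜ 1 := by
  have h : FrobTwist.tmul k 1 b • (1 : B) = b ^ 2 := by
    rw [Algebra.smul_def, mul_one]
    exact (relFrob_tmul k B 1 b).trans (one_smul k _)
  have h' := one_tmul_smul k (B := B) (FrobTwist.tmul k 1 b)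
  rwa [h] at h'

theorem one_tmul_algebraMap (r : k) :
    (1 : B) ⊗ₜ[FrobTwist k B] (algebraMap k B r) = (algebraMap k B r) ⊗ₜ 1 := by
  have h : FrobTwist.tmul k r (1 : B) • (1 : B) = algebraMap k B r := by
    rw [Algebra.smul_def, mul_one]
    exact (relFrob_tmul k B r 1).trans (by rw [one_pow, Algebra.smul_def, mul_one (algebraMap k B r)])
  have h' := one_tmul_smul k (FrobTwist.tmul k r (1 : B))
  rwa [h] at h'

theorem span_coord_eq_mulKer {σ : Type*} (e : MvPolynomial σ k ≃ₐ[k] B) :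
    Ideal.span (Set.range fun i => (1 : B) ⊗ₜ[FrobTwist k B] e (.X i) - e (.X i) ⊗ₜ 1) =
      mulKer k B := by
  refine le_antisymm (Ideal.span_le.2 ?_) ?_
  · rintro _ ⟨i, rfl⟩
    exact KaehlerDifferential.one_smul_sub_smul_one_mem_ideal _ _
  · change KaehlerDifferential.ideal (FrobTwist k B) B ≤ _
    rw [← KaehlerDifferential.span_range_eq_ideal, Ideal.span_le]
    rintro _ ⟨b, rfl⟩
    obtain ⟨p, rfl⟩ := e.surjective b
    simp only [SetLike.mem_coe]
    induction p using MvPolynomial.induction_on with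
    | C r =>
      rw [← MvPolynomial.algebraMap_eq, e.commutes, one_tmul_algebraMap, sub_self]
      exact zero_mem _
    | add p q hp hq =>
      rw [map_add, TensorProduct.tmul_add, TensorProduct.add_tmul, add_sub_add_comm]
      exact add_mem hp hq
    | mul_X p i hp =>
      have h : (1 : B) ⊗ₜ[FrobTwist k B] e (p * .X i) - e (p * .X i) ⊗ₜ 1 =
          (1 ⊗ₜ e p) * (1 ⊗ₜ e (.X i) - e (.X i) ⊗ₜ 1) +
            (1 ⊗ₜ e p - e p ⊗ₜ 1) * (e (.X i) ⊗ₜ 1) := by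
        rw [mul_sub, sub_mul]
        simp [Algebra.TensorProduct.tmul_mul_tmul]
      rw [h]
      exact add_mem (Ideal.mul_mem_left _ _ (Ideal.subset_span ⟨i, rfl⟩))
        (Ideal.mul_mem_right _ _ hp)

/-- The exterior coordinates `εᵢ = 1 ⊗ xᵢ - xᵢ ⊗ 1` on `J`, with the derivations `id ⊗ ∂/∂xᵢ`. -/
def exteriorCoordinates {σ : Type*} (e : MvPolynomial σ k ≃ₐ[k] B) :
    ExteriorCoordinates (mulKer k B) σ where
  coord i := 1 ⊗ₜ e (.X i) - e (.X i) ⊗ₜ 1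
  span_coord := span_coord_eq_mulKer k e
  coord_mul_self i := by
    have h2 := two_eq_zero_frobTensor k B
    have h := one_tmul_sq k (e (.X i))
    have h1 : ((1 : B) ⊗ₜ[FrobTwist k B] e (.X i)) * (1 ⊗ₜ e (.X i)) = 1 ⊗ₜ (e (.X i) ^ 2) := by
      rw [Algebra.TensorProduct.tmul_mul_tmul, one_mul, sq]
    have h3 : (e (.X i) ⊗ₜ[FrobTwist k B] (1 : B)) * (e (.X i) ⊗ₜ 1) = (e (.X i) ^ 2) ⊗ₜ 1 := by
      rw [Algebra.TensorProduct.tmul_mul_tmul, one_mul, sq]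
    linear_combination h1 + h3 + h + (e (.X i) ^ 2) ⊗ₜ[FrobTwist k B] (1 : B) * h2 -
      ((1 : B) ⊗ₜ[FrobTwist k B] e (.X i)) * (e (.X i) ⊗ₜ 1) * h2
  deriv i := tensorDerivation k (partialDerivation k e i)
  deriv_self i := by
    refine (tensorDerivation_one_tmul_sub k _ _).trans ?_
    rw [partialDerivation_apply, MvPolynomial.pderiv_X_self, map_one]
    rfl
  deriv_ne i j hij := by
    refine (tensorDerivation_one_tmul_sub k _ _).trans ?_
    rw [partialDerivation_apply,
      MvPolynomial.pderiv_X_of_ne hij.symm, map_zero, TensorProduct.tmul_zero]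

end Coordinates

/-! ### Completeness of towers of increasing connectivity -/

/-- A map of complexes is a quasi-isomorphism if it is injective and surjective on
homology; both conditions are phrased in terms of cycles and boundaries. -/
theorem quasiIso_of_forall {K L : ChainComplex AddCommGrpCat.{u} ℕ} (φ : K ⟶ L)
    (inj : ∀ i (x : K.X i), K.d i (i - 1) x = 0 → (∃ y, L.d (i + 1) i y = φ.f i x) →
      ∃ z, K.d (i + 1) i z = x)
    (surj : ∀ i (y : L.X i), L.d i (i - 1) y = 0 →
      ∃ x z, K.d i (i - 1) x = 0 ∧ φ.f i x = y + L.d (i + 1) i z) : QuasiIso φ := by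
  have hexact : ∀ (K : ChainComplex AddCommGrpCat.{u} ℕ) i (c : K.cycles i),
      K.homologyπ i c = 0 → ∃ y, K.toCycles (i + 1) i y = c := fun K i =>
    (ShortComplex.ab_exact_iff _).1 (ShortComplex.exact_of_g_is_cokernel
      (ShortComplex.mk _ _ (K.toCycles_comp_homologyπ (i + 1) i))
      (K.homologyIsCokernel (i + 1) i (by simp)))
  have hlift : ∀ i (x : K.X i), K.d i (i - 1) x = 0 → ∃ c, K.iCycles i c = x := fun i =>
    (ShortComplex.ab_exact_iff _).1 (ShortComplex.exact_of_f_is_kernel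
      (ShortComplex.mk _ _ (K.iCycles_d i (i - 1)))
      (K.cyclesIsKernel i (i - 1) (by cases i <;> simp)))
  have hmono : ∀ (K : ChainComplex AddCommGrpCat.{u} ℕ) i,
      Function.Injective (K.iCycles i) := fun K i =>
    (AddCommGrpCat.mono_iff_injective _).1 inferInstance
  have hepi : ∀ (K : ChainComplex AddCommGrpCat.{u} ℕ) i,
      Function.Surjective (K.homologyπ i) := fun K i =>
    (AddCommGrpCat.epi_iff_surjective _).1 inferInstance
  have hcyc : ∀ (K : ChainComplex AddCommGrpCat.{u} ℕ) i (c : K.cycles i),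
      K.d i (i - 1) (K.iCycles i c) = 0 := fun K i c =>
    ConcreteCategory.congr_hom (K.iCycles_d i (i - 1)) c
  have htoc : ∀ (K : ChainComplex AddCommGrpCat.{u} ℕ) i (y : K.X (i + 1)),
      K.iCycles i (K.toCycles (i + 1) i y) = K.d (i + 1) i y := fun K i y =>
    ConcreteCategory.congr_hom (K.toCycles_i (i + 1) i) y
  have hπ : ∀ (K : ChainComplex AddCommGrpCat.{u} ℕ) i (y : K.X (i + 1)),
      K.homologyπ i (K.toCycles (i + 1) i y) = 0 := fun K i y =>
    ConcreteCategory.congr_hom (K.toCycles_comp_homologyπ (i + 1) i) y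
  have hφ : ∀ i (c : K.cycles i), L.iCycles i (HomologicalComplex.cyclesMap φ i c) =
      φ.f i (K.iCycles i c) := fun i c =>
    ConcreteCategory.congr_hom (HomologicalComplex.cyclesMap_i φ i) c
  have hnat : ∀ i (c : K.cycles i), HomologicalComplex.homologyMap φ i (K.homologyπ i c) =
      L.homologyπ i (HomologicalComplex.cyclesMap φ i c) := fun i c =>
    ConcreteCategory.congr_hom (HomologicalComplex.homologyπ_naturality φ i) c
  refine ⟨fun i => (quasiIsoAt_iff_isIso_homologyMap _ _).2 ?_⟩
  refine (ConcreteCategory.isIso_iff_bijective _).2 ⟨?_, fun h => ?_⟩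
  · refine (injective_iff_map_eq_zero (HomologicalComplex.homologyMap φ i).hom).2 fun h hh => ?_
    obtain ⟨c, rfl⟩ := hepi K i h
    obtain ⟨y, hy⟩ := hexact L i _ ((hnat i c).symm.trans hh)
    obtain ⟨z, hz⟩ := inj i (K.iCycles i c) (hcyc K i c) ⟨y, by rw [← htoc, hy, hφ]⟩
    rw [← htoc] at hz
    rw [← hmono K i hz, hπ]
  · obtain ⟨c, rfl⟩ := hepi L i h
    obtain ⟨x, z, hx, hxz⟩ := surj i (L.iCycles i c) (hcyc L i c)
    obtain ⟨c', rfl⟩ := hlift i x hx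
    refine ⟨K.homologyπ i c', ?_⟩
    have : HomologicalComplex.cyclesMap φ i c' = c + L.toCycles (i + 1) i z := by
      refine hmono L i ?_
      rw [hφ, hxz, map_add, htoc]
    rw [hnat, this, map_add, hπ, add_zero]

/-- The elements of a product of complexes are the families of elements. -/
theorem exists_unique_pi (X : ℕ → ChainComplex AddCommGrpCat.{u} ℕ) (i : ℕ)
    (x : ∀ n, (X n).X i) : ∃! y : (∏ᶜ X).X i, ∀ n, (Pi.π X n).f i y = x n := by
  have t := isLimitOfHasProductOfPreservesLimit
    (HomologicalComplex.eval AddCommGrpCat.{u} (ComplexShape.down ℕ) i ⋙ forget _) X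
  obtain ⟨y, hy, huniq⟩ := (Types.isLimit_iff _).1 ⟨t⟩ (fun n => x n.as) (by
    rintro ⟨m⟩ ⟨n⟩ ⟨⟨rfl : m = n⟩⟩
    rfl)
  exact ⟨y, fun n => hy ⟨n⟩, fun z hz => huniq z fun n => hz n.as⟩

/-- The equations `xₙ - f xₙ₊₁ = yₙ` for `n < N`, solved by descending recursion from `x_N = 0`. -/
theorem exists_sub_eq {G : ℕ → Type*} [∀ n, AddCommGroup (G n)] (f : ∀ n, G (n + 1) →+ G n)
    (y : ∀ n, G n) (N : ℕ) :
    ∃ x : ∀ n, G n, (∀ n < N, x n - f n (x (n + 1)) = y n) ∧ ∀ n, N ≤ n → x n = 0 := by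
  induction N generalizing G with
  | zero => exact ⟨0, by simp, by simp⟩
  | succ N ih =>
    obtain ⟨x, hx, hx'⟩ := ih (fun n => f (n + 1)) fun n => y (n + 1)
    refine ⟨fun | 0 => y 0 + f 0 (x 0) | n + 1 => x n, ?_, ?_⟩
    · rintro (_ | n) hn
      · exact add_sub_cancel_right _ _
      · exact hx n (by omega)
    · rintro (_ | n) hn
      · omega
      · exact hx' n (by omega)

/-- Descending induction. -/
theorem of_forall_ge {p : ℕ → Prop} (N : ℕ) (h : ∀ n, N ≤ n → p n)
    (hstep : ∀ n, p (n + 1) → p n) (n : ℕ) : p n := by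
  suffices ∀ k n, N ≤ n + k → p n from this N n (by omega)
  intro k
  induction k with
  | zero => exact h
  | succ k ih => exact fun n hn => hstep n (ih (n + 1) (by omega))

/-- A tower whose `n`-th term is `(n - 1)`-connected has vanishing limit: in degree `i` only the terms
with `n ≤ i` contribute to homology. -/
theorem isCompleteTower_of_isConnectedUpTo (X : ℕ → ChainComplex AddCommGrpCat.{u} ℕ)
    (f : ∀ n, X (n + 1) ⟶ X n) (h : ∀ n, IsConnectedUpTo (X n) ((n : ℤ) - 1)) :
    IsCompleteTower X f := by
  have ext : ∀ i (x y : (∏ᶜ X).X i), (∀ n, (Pi.π X n).f i x = (Pi.π X n).f i y) → x = y :=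
    fun i x y hxy => (exists_unique_pi X i fun n => (Pi.π X n).f i y).unique hxy fun _ => rfl
  have hd : ∀ n i j (x : (∏ᶜ X).X i),
      (Pi.π X n).f j ((∏ᶜ X).d i j x) = (X n).d i j ((Pi.π X n).f i x) := fun n i j x =>
    (ConcreteCategory.congr_hom ((Pi.π X n).comm i j) x).symm
  have hfd : ∀ n i j (x : (X (n + 1)).X i),
      (f n).f j ((X (n + 1)).d i j x) = (X n).d i j ((f n).f i x) := fun n i j x =>
    (ConcreteCategory.congr_hom ((f n).comm i j) x).symm
  have hs : ∀ n i (x : (∏ᶜ X).X i), (Pi.π X n).f i ((oneSubShift X f).f i x) =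
      (Pi.π X n).f i x - (f n).f i ((Pi.π X (n + 1)).f i x) := by
    intro n i x
    have h1 : oneSubShift X f ≫ Pi.π X n = Pi.π X n - Pi.π X (n + 1) ≫ f n := by
      simp [oneSubShift, Preadditive.sub_comp]
    exact ConcreteCategory.congr_hom (congrArg (fun g => g.f i) h1) x
  have hexact : ∀ i n, i + 1 ≤ n → ∀ x : (X n).X i, (X n).d i (i - 1) x = 0 →
      ∃ y, (X n).d (i + 1) i y = x := fun i n hn =>
    (isZero_homology_iff _ _).1 (h n i (by omega))
  refine quasiIso_of_forall _ ?_ ?_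
  · rintro i x hx ⟨y, hy⟩
    have key : ∀ n, ∃ z, (X n).d (i + 1) i z = (Pi.π X n).f i x := by
      refine of_forall_ge (i + 1) (fun n hn => hexact i n hn _ ?_) ?_
      · rw [← hd, hx, map_zero]
      · rintro n ⟨z, hz⟩
        refine ⟨(f n).f (i + 1) z + (Pi.π X n).f (i + 1) y, ?_⟩
        rw [map_add, ← hfd, hz, ← hd, hy, hs]
        abel
    choose z hz using key
    obtain ⟨z', hz', -⟩ := exists_unique_pi X (i + 1) z
    exact ⟨z', ext i _ _ fun n => by rw [hd, hz', hz]⟩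
  · intro i y hy
    obtain ⟨x, hx, hx0⟩ := exists_sub_eq (G := fun n => (X n).X i) (fun n => ((f n).f i).hom)
      (fun n => (Pi.π X n).f i y) (i + 1)
    replace hx : ∀ n < i + 1, x n - (f n).f i (x (n + 1)) = (Pi.π X n).f i y := hx
    have hycyc : ∀ n, (X n).d i (i - 1) ((Pi.π X n).f i y) = 0 := fun n => by
      rw [← hd, hy, map_zero]
    have hxcyc : ∀ n, (X n).d i (i - 1) (x n) = 0 := by
      refine of_forall_ge (i + 1) (fun n hn => by rw [hx0 n hn, map_zero]) fun n hn => ?_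
      by_cases hni : n < i + 1
      · rw [sub_eq_iff_eq_add.1 (hx n hni), map_add, hycyc, ← hfd, hn, map_zero, add_zero]
      · rw [hx0 n (by omega), map_zero]
    have key : ∀ n, ∃ z, x n - (f n).f i (x (n + 1)) =
        (Pi.π X n).f i y + (X n).d (i + 1) i z := by
      intro n
      by_cases hni : n < i + 1
      · exact ⟨0, by rw [hx n hni, map_zero, add_zero]⟩
      · obtain ⟨z, hz⟩ := hexact i n (by omega) _ (hycyc n)
        exact ⟨-z, by rw [map_neg, hz, hx0 n (by omega), hx0 (n + 1) (by omega), map_zero]; abel⟩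
    choose z hz using key
    obtain ⟨x', hx', -⟩ := exists_unique_pi X i x
    obtain ⟨z', hz', -⟩ := exists_unique_pi X (i + 1) z
    refine ⟨x', z', ext _ _ _ fun n => ?_, ext _ _ _ fun n => ?_⟩
    · rw [hd, hx', hxcyc, map_zero]
    · rw [hs, map_add, hd, hx', hx', hz', hz]

/-! ### The simplicial ideal of a polynomial resolution -/

section Resolution

variable {R : Type u} [CommRing R] {A : SimplicialObject (CommAlgCat.{u} R)}
  (P : PolynomialResolution R A)

/-- The simplicial ring `C = B ⊗_{B⁽¹⁾} B` of a polynomial resolution. -/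
def frobTensorObject : SimplicialObject CommRingCat.{u} where
  obj X := CommRingCat.of (FrobTensor (ModTwo R) (BaseModTwo R (P.alg.obj X)))
  map f := CommRingCat.ofHom (FrobTensor.map (ModTwo R) (BaseModTwo.map R (P.alg.map f).hom))
  map_id X := by
    refine CommRingCat.hom_ext (RingHom.ext fun x => ?_)
    change FrobTensor.map (ModTwo R) (BaseModTwo.map R (P.alg.map (𝟙 X)).hom) x = x
    rw [P.alg.map_id]
    exact (congrArg (fun g => FrobTensor.map _ g x) (BaseModTwo.map_id R _)).trans
      (FrobTensor.map_id _ x)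
  map_comp f g := by
    refine CommRingCat.hom_ext (RingHom.ext fun x => ?_)
    change FrobTensor.map (ModTwo R) (BaseModTwo.map R (P.alg.map (f ≫ g)).hom) x = _
    rw [P.alg.map_comp]
    exact (congrArg (fun g => FrobTensor.map _ g x) (BaseModTwo.map_comp R _ _)).trans
      (FrobTensor.map_comp _ _ _ x)

/-- The simplicial ideal `J` of `C`. -/
def mulKerObject : SimplicialIdeal (frobTensorObject P) where
  ideal X := mulKer (ModTwo R) (BaseModTwo R (P.alg.obj X))
  le_comap f := mulKer_le_comap (ModTwo R) (BaseModTwo.map R (P.alg.map f).hom)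

theorem isConnectedUpTo_leftKan_powJ (hJ : IsConnectedUpTo (leftKan (powJ R 1) P) 0) (n : ℕ) :
    IsConnectedUpTo (leftKan (powJ R n) P) ((n : ℤ) - 1) := by
  -- `leftKan (powJ R n) P` is the complex of `(mulKerObject P).pow n` by definition
  refine (mulKerObject P).isConnectedUpTo_pow ?_ ?_ hJ n
  · intro X
    exact two_eq_zero_frobTensor (ModTwo R) (BaseModTwo R (P.alg.obj X))
  · intro X
    obtain ⟨σ, ⟨e⟩⟩ := P.polynomial X
    exact ⟨σ, ⟨exteriorCoordinates (ModTwo R)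
      ((MvPolynomial.algebraTensorAlgEquiv R (ModTwo R)).symm.trans
        (Algebra.TensorProduct.congr AlgEquiv.refl e))⟩⟩

end Resolution

end RealHochschild

end

theorem proposition5p20 (R : Type u) [CommRing R]
    (A : SimplicialObject (CommAlgCat.{u} R)) (P : RealHochschild.PolynomialResolution R A)
    (hJ : RealHochschild.IsConnectedUpTo (RealHochschild.leftKan (RealHochschild.powJ R 1) P) 0) :
    (∀ n : ℕ, 1 ≤ n → RealHochschild.IsConnectedUpTo
      (RealHochschild.leftKan (RealHochschild.powJ R n) P) ((n : ℤ) - 1)) ∧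
    RealHochschild.IsCompleteTower
      (fun n => RealHochschild.leftKan (RealHochschild.powJ R n) P)
      (fun n => RealHochschild.leftKanMap (RealHochschild.powJIncl R n) P) :=
  ⟨fun n _ => RealHochschild.isConnectedUpTo_leftKan_powJ P hJ n,
    RealHochschild.isCompleteTower_of_isConnectedUpTo _ _
      (RealHochschild.isConnectedUpTo_leftKan_powJ P hJ)⟩
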